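/- Let $n\ge 0$ be an integer, let $u\in\mathbb C$ with $u\neq 0$, and let $\alpha\in\mathbb C$. Write $s_{ij}\in S_n$ for the transposition of $i$ and $j$, $s_i=s_{i,i+1}$, and $[a,b]=ab-ba$. The rational double affine Hecke-Clifford algebra $\ddot{\mathfrak H}^{\mathfrak c}$ is the unital associative $\mathbb C$-algebra generated by $x_i,y_i,c_i$ $(1\le i\le n)$ and the group $S_n$, subject to the relations $$x_ix_j=x_jx_i,\quad y_iy_j=y_jy_i,\quad \sigma x_i=x_{\sigma i}\sigma,\quad \sigma y_i=y_{\sigma i}\sigma\quad(\sigma\in S_n),$$ $$c_ix_i=-x_ic_i,\quad c_iy_i=y_ic_i,\quad c_jx_i=x_ic_j,\quad c_jy_i=y_ic_j\quad(i\ne j),$$ $$\sigma c_i=c_{\sigma i}\sigma\quad(\sigma\in S_n),\quad c_i^2=1,\quad c_ic_j=-c_jc_i\quad(i\neq j),\qquad(\ast)$$ $$[y_j,x_i]=u(1+c_jc_i)s_{ij}\quad(i\ne j),\qquad [y_i,x_i]=-u\sum_{k\neq i}(1+c_kc_i)s_{ki}.$$ Nazarov's degenerate affine Hecke-Clifford algebra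 $\mathfrak H^{\mathfrak c}$ is the unital associative $\mathbb C$-algebra generated by $a_i,c_i$ $(1\le i\le n)$ and the group $S_n$, subject to the relations $(\ast)$ and $$a_js_i=s_ia_j\ (j\neq i,i+1),\quad a_{i+1}s_i-s_ia_i=1-c_{i+1}c_i,\quad c_ia_i=-a_ic_i,\quad a_ia_j=a_ja_i,\quad c_ja_i=a_ic_j\ (i\ne j).$$ In $\ddot{\mathfrak H}^{\mathfrak c}$ put $$M_i=\sum_{k<i}(1-c_ic_k)s_{ki},\qquad z_i=u^{-1}y_ix_i+M_i\qquad(1\le i\le n).$$ Theorem. The subalgebra of $\ddot{\mathfrak H}^{\mathfrak c}$ generated by the $c_i$, the elements $\alpha x_i+z_i$ $(1\le i\le n)$ and $S_n$ is isomorphic to $\mathfrak H^{\mathfrak c}$. More precisely, there is an isomorphism of $\mathbb C$-algebras from $\mathfrak H^{\mathfrak c}$ onto this subalgebra that sends $a_i\mapsto\alpha x_i+z_i$ and $c_i\mapsto c_i$ for all $i$, and $\sigma\mapsto\sigma$ for all $\sigma\in S_n$. -/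

import Mathlib

/-! ### The rational double affine Hecke-Clifford algebra -/

/-- Generators of the rational double affine Hecke-Clifford algebra: `x i`, `y i`, `c i`
(with `i` running over `n` indices) and the elements of the symmetric group. -/
inductive DAHCaGen (n : ℕ) : Type
  | x (i : Fin n)
  | y (i : Fin n)
  | c (i : Fin n)
  | perm (σ : Equiv.Perm (Fin n))

namespace DAHCaGen

/-- The generator `x i`, in the free algebra. -/
noncomputable def X {n : ℕ} (i : Fin n) : FreeAlgebra ℂ (DAHCaGen n) := FreeAlgebra.ι ℂ (x i)

/-- The generator `y i`, in the free algebra. -/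
noncomputable def Y {n : ℕ} (i : Fin n) : FreeAlgebra ℂ (DAHCaGen n) := FreeAlgebra.ι ℂ (y i)

/-- The generator `c i`, in the free algebra. -/
noncomputable def C {n : ℕ} (i : Fin n) : FreeAlgebra ℂ (DAHCaGen n) := FreeAlgebra.ι ℂ (c i)

/-- The generator given by the permutation `σ`, in the free algebra. -/
noncomputable def S {n : ℕ} (σ : Equiv.Perm (Fin n)) : FreeAlgebra ℂ (DAHCaGen n) :=
  FreeAlgebra.ι ℂ (perm σ)

end DAHCaGen

open DAHCaGen in
/-- Defining relations of the rational double affine Hecke-Clifford algebra with parameter `u`.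
The relations `perm_one` and `perm_mul` say that the symmetric group maps multiplicatively. -/
inductive DAHCaRel (n : ℕ) (u : ℂ) :
    FreeAlgebra ℂ (DAHCaGen n) → FreeAlgebra ℂ (DAHCaGen n) → Prop
  | perm_one : DAHCaRel n u (S 1) 1
  | perm_mul (σ τ : Equiv.Perm (Fin n)) : DAHCaRel n u (S (σ * τ)) (S σ * S τ)
  | x_comm (i j : Fin n) : DAHCaRel n u (X i * X j) (X j * X i)
  | y_comm (i j : Fin n) : DAHCaRel n u (Y i * Y j) (Y j * Y i)
  | perm_x (σ : Equiv.Perm (Fin n)) (i : Fin n) : DAHCaRel n u (S σ * X i) (X (σ i) * S σ)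
  | perm_y (σ : Equiv.Perm (Fin n)) (i : Fin n) : DAHCaRel n u (S σ * Y i) (Y (σ i) * S σ)
  | perm_c (σ : Equiv.Perm (Fin n)) (i : Fin n) : DAHCaRel n u (S σ * C i) (C (σ i) * S σ)
  | c_x_same (i : Fin n) : DAHCaRel n u (C i * X i) (-(X i * C i))
  | c_x_ne (i j : Fin n) (h : i ≠ j) : DAHCaRel n u (C j * X i) (X i * C j)
  | c_y (i j : Fin n) : DAHCaRel n u (C j * Y i) (Y i * C j)
  | c_sq (i : Fin n) : DAHCaRel n u (C i * C i) 1
  | c_anticomm (i j : Fin n) (h : i ≠ j) : DAHCaRel n u (C i * C j) (-(C j * C i))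
  | y_x_ne (i j : Fin n) (h : i ≠ j) :
      DAHCaRel n u (Y j * X i - X i * Y j) (u • ((1 + C j * C i) * S (Equiv.swap i j)))
  | y_x_same (i : Fin n) :
      DAHCaRel n u (Y i * X i - X i * Y i)
        (-(u • ∑ k ∈ Finset.univ.erase i, (1 + C k * C i) * S (Equiv.swap k i)))

/-- The rational double affine Hecke-Clifford algebra with parameter `u`. -/
abbrev DAHCa (n : ℕ) (u : ℂ) : Type := RingQuot (DAHCaRel n u)

namespace DAHCa

/-- The generator `x_i` of the double affine Hecke-Clifford algebra. -/
noncomputable def x {n : ℕ} (u : ℂ) (i : Fin n) : DAHCa n u :=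
  RingQuot.mkAlgHom ℂ (DAHCaRel n u) (DAHCaGen.X i)

/-- The generator `y_i` of the double affine Hecke-Clifford algebra. -/
noncomputable def y {n : ℕ} (u : ℂ) (i : Fin n) : DAHCa n u :=
  RingQuot.mkAlgHom ℂ (DAHCaRel n u) (DAHCaGen.Y i)

/-- The generator `c_i` of the double affine Hecke-Clifford algebra. -/
noncomputable def c {n : ℕ} (u : ℂ) (i : Fin n) : DAHCa n u :=
  RingQuot.mkAlgHom ℂ (DAHCaRel n u) (DAHCaGen.C i)

/-- The element of the double affine Hecke-Clifford algebra given by a permutation. -/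
noncomputable def perm {n : ℕ} (u : ℂ) (σ : Equiv.Perm (Fin n)) : DAHCa n u :=
  RingQuot.mkAlgHom ℂ (DAHCaRel n u) (DAHCaGen.S σ)

/-- The Jucys-Murphy element `M_i = ∑_{k < i} (1 - c_i c_k) s_{ki}`. -/
noncomputable def jucysMurphy {n : ℕ} (u : ℂ) (i : Fin n) : DAHCa n u :=
  ∑ k ∈ Finset.Iio i, (1 - c u i * c u k) * perm u (Equiv.swap k i)

/-- The element `z_i = u⁻¹ y_i x_i + M_i`. -/
noncomputable def z {n : ℕ} (u : ℂ) (i : Fin n) : DAHCa n u :=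
  u⁻¹ • (y u i * x u i) + jucysMurphy u i

end DAHCa

/-! ### The degenerate affine Hecke-Clifford algebra -/

/-- Generators of the degenerate affine Hecke-Clifford algebra: `a i`, `c i` and the elements
of the symmetric group. -/
inductive AffHCGen (n : ℕ) : Type
  | a (i : Fin n)
  | c (i : Fin n)
  | perm (σ : Equiv.Perm (Fin n))

namespace AffHCGen

/-- The generator `a i`, in the free algebra. -/
noncomputable def A {n : ℕ} (i : Fin n) : FreeAlgebra ℂ (AffHCGen n) := FreeAlgebra.ι ℂ (a i)

/-- The generator `c i`, in the free algebra. -/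
noncomputable def C {n : ℕ} (i : Fin n) : FreeAlgebra ℂ (AffHCGen n) := FreeAlgebra.ι ℂ (c i)

/-- The generator given by the permutation `σ`, in the free algebra. -/
noncomputable def S {n : ℕ} (σ : Equiv.Perm (Fin n)) : FreeAlgebra ℂ (AffHCGen n) :=
  FreeAlgebra.ι ℂ (perm σ)

end AffHCGen

open AffHCGen in
/-- Defining relations of the degenerate affine Hecke-Clifford algebra. In `a_perm_ne` and
`a_perm_succ` the index `i'` is `i + 1`, so that `Equiv.swap i i'` is the simple
transposition `s_i`. -/
inductive AffHCRel (n : ℕ) : FreeAlgebra ℂ (AffHCGen n) → FreeAlgebra ℂ (AffHCGen n) → Prop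
  | perm_one : AffHCRel n (S 1) 1
  | perm_mul (σ τ : Equiv.Perm (Fin n)) : AffHCRel n (S (σ * τ)) (S σ * S τ)
  | perm_c (σ : Equiv.Perm (Fin n)) (i : Fin n) : AffHCRel n (S σ * C i) (C (σ i) * S σ)
  | c_sq (i : Fin n) : AffHCRel n (C i * C i) 1
  | c_anticomm (i j : Fin n) (h : i ≠ j) : AffHCRel n (C i * C j) (-(C j * C i))
  | a_perm_ne (i i' j : Fin n) (hi : (i : ℕ) + 1 = (i' : ℕ)) (h : j ≠ i) (h' : j ≠ i') :
      AffHCRel n (A j * S (Equiv.swap i i')) (S (Equiv.swap i i') * A j)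
  | a_perm_succ (i i' : Fin n) (hi : (i : ℕ) + 1 = (i' : ℕ)) :
      AffHCRel n (A i' * S (Equiv.swap i i') - S (Equiv.swap i i') * A i) (1 - C i' * C i)
  | c_a_same (i : Fin n) : AffHCRel n (C i * A i) (-(A i * C i))
  | a_comm (i j : Fin n) : AffHCRel n (A i * A j) (A j * A i)
  | c_a_ne (i j : Fin n) (h : i ≠ j) : AffHCRel n (C j * A i) (A i * C j)

/-- The degenerate affine Hecke-Clifford algebra (affine Sergeev algebra) of Nazarov, in the
normalization `c_i ^ 2 = 1`. -/
abbrev AffHC (n : ℕ) : Type := RingQuot (AffHCRel n)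

namespace AffHC

/-- The generator `a_i` of the degenerate affine Hecke-Clifford algebra. -/
noncomputable def a {n : ℕ} (i : Fin n) : AffHC n :=
  RingQuot.mkAlgHom ℂ (AffHCRel n) (AffHCGen.A i)

/-- The generator `c_i` of the degenerate affine Hecke-Clifford algebra. -/
noncomputable def c {n : ℕ} (i : Fin n) : AffHC n :=
  RingQuot.mkAlgHom ℂ (AffHCRel n) (AffHCGen.C i)

/-- The element of the degenerate affine Hecke-Clifford algebra given by a permutation. -/
noncomputable def perm {n : ℕ} (σ : Equiv.Perm (Fin n)) : AffHC n :=
  RingQuot.mkAlgHom ℂ (AffHCRel n) (AffHCGen.S σ)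

end AffHC

/-! ### The affine Hecke-Clifford subalgebra -/

/-- The subalgebra of the double affine Hecke-Clifford algebra generated by the `c_i`, the
elements `α x_i + z_i`, and the symmetric group. -/
noncomputable def DAHCa.affineSubalgebra (n : ℕ) (u α : ℂ) : Subalgebra ℂ (DAHCa n u) :=
  Algebra.adjoin ℂ
    (Set.range (fun i : Fin n => DAHCa.c u i) ∪
      Set.range (fun i : Fin n => α • DAHCa.x u i + DAHCa.z u i) ∪
      Set.range (fun σ : Equiv.Perm (Fin n) => DAHCa.perm u σ))

/-!
# The degenerate affine Hecke-Clifford algebra inside the double affine one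

Put `y'_i = y_i / u + α`. The relations of the double affine algebra involve the `y_i` only through
commutators, so `y'_i` satisfies the same relations with parameter `1`, and `α x_i + z_i` becomes
`y'_i x_i + M_i`, where `M_i` is the sum over `k < i` of the odd transpositions
`(1 + c_k c_i) s_{ik}`. Both the shift and the scaling thus disappear
(`IsDAHCSystem.of_rescaled`, `DAHCa.affine_eq`).

The elements `y_i x_i + M_i` satisfy the relations of the affine algebra. The essential point is
that they commute: for `i < j` the commutator of `y_i x_i` and `y_j x_j` cancels that of `y_i x_i`
with the summand of `M_j` at `i` (`IsDAHCSystem.affine_comm_of_lt`). This gives a homomorphism from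
the affine algebra onto the subalgebra in question.

It is injective because the composite with a suitable representation is. The representation is
built from two commuting pieces: coordinates `y_i` with divided differences
`Δ_{ik} = (1 - q_{ik}) / (y_i - y_k)` on functions on a regular orbit of the symmetric group, and
an action of Clifford generators `c_i`, permutations and odd elements `ξ_i`. The Dunkl elements
`x_i = ξ_i + ∑_k Δ_{ik} (1 + c_k c_i) p_{ik}` satisfy the relations of the double affine algebra,
because the `Δ_{ik}` square to zero and satisfy the classical Yang-Baxter equation
(`IsModel.isDAHCSystem`).

Give `ξ_i` degree one. Then `y_i x_i + M_i` is `y_i ξ_i` plus terms of degree zero, and the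
monomials in the `a_i` times Clifford monomials times permutations have independent leading terms
on a vacuum vector (`DunklModel.linearIndependent_pbwMonomial`). These monomials span the affine
algebra (`IsAffineSystem.span_pbwMonomial_multiset`), whence injectivity.
-/

open Equiv (swap)

/-! ### Odd transpositions and Jucys-Murphy elements -/

section Systems

variable {n : ℕ} {R : Type*} [Ring R]

/-- The relations of the Sergeev algebra: `s` is a copy of the symmetric group permuting the
Clifford generators `c i`. -/
structure IsSergeevSystem (c : Fin n → R) (s : Equiv.Perm (Fin n) →* R) : Prop where
  perm_c : ∀ σ i, s σ * c i = c (σ i) * s σ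
  c_sq : ∀ i, c i * c i = 1
  c_anticomm : ∀ i j, i ≠ j → c i * c j = -(c j * c i)

/-- A commuting family `x` permuted by the symmetric group, where `x i` is odd for the `i`-th
Clifford generator and even for the others. -/
structure IsOddFamily (c : Fin n → R) (s : Equiv.Perm (Fin n) →* R) (x : Fin n → R) : Prop where
  comm : ∀ i j, x i * x j = x j * x i
  perm : ∀ σ i, s σ * x i = x (σ i) * s σ
  c_same : ∀ i, c i * x i = -(x i * c i)
  c_ne : ∀ i j, i ≠ j → c j * x i = x i * c j

/-- The odd transposition `(1 + c_k c_i) s_{ik}`. It is not symmetric in `i` and `k`: exchanging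
them changes the sign of `c_k c_i`. -/
def oddSwap (c : Fin n → R) (s : Equiv.Perm (Fin n) →* R) (i k : Fin n) : R :=
  (1 + c k * c i) * s (swap i k)

/-- The relations of the rational double affine Hecke-Clifford algebra with parameter `u = 1`, for
elements of an arbitrary ring. -/
structure IsDAHCSystem (c : Fin n → R) (s : Equiv.Perm (Fin n) →* R) (x y : Fin n → R) : Prop where
  sergeev : IsSergeevSystem c s
  odd : IsOddFamily c s x
  y_comm : ∀ i j, y i * y j = y j * y i
  perm_y : ∀ σ i, s σ * y i = y (σ i) * s σ
  c_y : ∀ i j, c j * y i = y i * c j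
  y_x_ne : ∀ i j, i ≠ j → y j * x i - x i * y j = oddSwap c s i j
  y_x_same : ∀ i, y i * x i - x i * y i = -∑ k ∈ Finset.univ.erase i, oddSwap c s i k

namespace IsSergeevSystem

variable {c : Fin n → R} {s : Equiv.Perm (Fin n) →* R} (h : IsSergeevSystem c s)
include h

theorem perm_oddSwap (σ : Equiv.Perm (Fin n)) (i k : Fin n) :
    s σ * oddSwap c s i k = oddSwap c s (σ i) (σ k) * s σ := by
  have hs : s σ * s (swap i k) = s (swap (σ i) (σ k)) * s σ := by
    rw [← map_mul, ← map_mul, Equiv.mul_swap_eq_swap_mul]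
  unfold oddSwap
  calc s σ * ((1 + c k * c i) * s (swap i k))
      = (s σ + s σ * c k * c i) * s (swap i k) := by noncomm_ring
    _ = (1 + c (σ k) * c (σ i)) * (s σ * s (swap i k)) := by
        rw [h.perm_c, mul_assoc, h.perm_c]; noncomm_ring
    _ = _ := by rw [hs, mul_assoc]

theorem c_oddSwap_left {i k : Fin n} (hik : i ≠ k) :
    c i * oddSwap c s i k = -(oddSwap c s i k * c i) := by
  have h1 : s (swap i k) * c i = c k * s (swap i k) := by simp [h.perm_c]
  unfold oddSwap
  rw [mul_assoc, h1, ← mul_assoc, ← mul_assoc, ← neg_mul]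
  congr 1
  have e1 : c i * (c k * c i) = -c k := by
    rw [h.c_anticomm k i hik.symm, mul_neg, ← mul_assoc, h.c_sq, one_mul]
  have e2 : c k * c i * c k = -c i := by
    rw [h.c_anticomm k i hik.symm, neg_mul, mul_assoc, h.c_sq, mul_one]
  rw [mul_add, add_mul, e1, e2]; noncomm_ring

theorem c_oddSwap_right (i k : Fin n) :
    c k * oddSwap c s i k = oddSwap c s i k * c k := by
  have h1 : s (swap i k) * c k = c i * s (swap i k) := by simp [h.perm_c]
  unfold oddSwap
  rw [mul_assoc, h1, ← mul_assoc, ← mul_assoc]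
  congr 1
  rw [mul_add, add_mul, ← mul_assoc, h.c_sq, mul_assoc (c k), h.c_sq]
  noncomm_ring

theorem c_mul_c_comm {i j k : Fin n} (hi : i ≠ k) (hj : j ≠ k) :
    c k * (c i * c j) = c i * c j * c k := by
  rw [← mul_assoc, h.c_anticomm k i hi.symm, neg_mul, mul_assoc, h.c_anticomm k j hj.symm]
  noncomm_ring

theorem c_oddSwap_ne {i k l : Fin n} (hi : i ≠ l) (hk : k ≠ l) :
    c l * oddSwap c s i k = oddSwap c s i k * c l := by
  have h1 : s (swap i k) * c l = c l * s (swap i k) := by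
    rw [h.perm_c, Equiv.swap_apply_of_ne_of_ne hi.symm hk.symm]
  unfold oddSwap
  rw [mul_assoc, h1, ← mul_assoc, ← mul_assoc, mul_add, add_mul, h.c_mul_c_comm hk hi]
  simp [add_mul]

/-- The Clifford coefficient of the three-cycle has the same form for the three products
considered in `oddSwap_mul_rotate` and `oddSwap_mul_rotate'`, which is why these products agree.
-/
theorem oddSwap_mul_expand {i j k : Fin n} (hjk : j ≠ k) (hik : i ≠ k) :
    oddSwap c s i j * oddSwap c s j k =
      (1 + c k * c i + c j * c i + c k * c j) * s (swap i j * swap j k) := by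
  have h1 : s (swap i j) * (c k * c j) = c k * c i * s (swap i j) := by
    rw [← mul_assoc, h.perm_c, Equiv.swap_apply_of_ne_of_ne hik.symm hjk.symm, mul_assoc,
      h.perm_c, Equiv.swap_apply_right, mul_assoc]
  have e : c j * c i * (c k * c i) = c k * c j := by
    rw [h.c_anticomm k i hik.symm, mul_neg, mul_assoc, ← mul_assoc (c i), h.c_sq, one_mul,
      h.c_anticomm j k hjk, neg_neg]
  unfold oddSwap
  calc (1 + c j * c i) * s (swap i j) * ((1 + c k * c j) * s (swap j k))
      = (1 + c j * c i) * (s (swap i j) + s (swap i j) * (c k * c j)) * s (swap j k) := by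
        noncomm_ring
    _ = (1 + c k * c i + c j * c i + c j * c i * (c k * c i)) *
          (s (swap i j) * s (swap j k)) := by
        rw [h1]; noncomm_ring
    _ = _ := by rw [e, map_mul]

/-- The relation between the three products of odd transpositions that lie over the same
three-cycle. -/
theorem oddSwap_mul_rotate {i j k : Fin n} (hij : i ≠ j) (hjk : j ≠ k) (hik : i ≠ k) :
    oddSwap c s i j * oddSwap c s j k = oddSwap c s j k * oddSwap c s i k := by
  have h1 : s (swap j k) * (c k * c i) = c j * c i * s (swap j k) := by
    rw [← mul_assoc, h.perm_c, Equiv.swap_apply_right, mul_assoc,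
      h.perm_c, Equiv.swap_apply_of_ne_of_ne hij hik, mul_assoc]
  have e : c k * c j * (c j * c i) = c k * c i := by
    rw [mul_assoc, ← mul_assoc (c j), h.c_sq, one_mul]
  have hs : swap i j * swap j k = swap j k * swap i k := by
    rw [Equiv.mul_swap_eq_swap_mul (swap j k), Equiv.swap_apply_right,
      Equiv.swap_apply_of_ne_of_ne hij hik]
  rw [h.oddSwap_mul_expand hjk hik, hs]
  unfold oddSwap
  calc (1 + c k * c i + c j * c i + c k * c j) * s (swap j k * swap i k)
      = (1 + c j * c i + c k * c j + c k * c j * (c j * c i)) *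
          (s (swap j k) * s (swap i k)) := by rw [e, map_mul]; noncomm_ring
    _ = (1 + c k * c j) * (s (swap j k) + c j * c i * s (swap j k)) * s (swap i k) := by
        noncomm_ring
    _ = _ := by rw [← h1]; noncomm_ring

/-- The remaining product of odd transpositions over the three-cycle of `oddSwap_mul_rotate`. -/
theorem oddSwap_mul_rotate' {i j k : Fin n} (hij : i ≠ j) (hjk : j ≠ k) (hik : i ≠ k) :
    oddSwap c s i k * oddSwap c s j i = oddSwap c s i j * oddSwap c s j k := by
  have h1 : s (swap i k) * (c i * c j) = c k * c j * s (swap i k) := by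
    rw [← mul_assoc, h.perm_c, Equiv.swap_apply_left, mul_assoc,
      h.perm_c, Equiv.swap_apply_of_ne_of_ne hij.symm hjk, mul_assoc]
  have e : c k * c i * (c k * c j) = c j * c i := by
    rw [h.c_anticomm k i hik.symm, neg_mul, mul_assoc, ← mul_assoc (c k), h.c_sq, one_mul,
      h.c_anticomm j i hij.symm]
  have hs : swap i j * swap j k = swap i k * swap j i := by
    rw [Equiv.mul_swap_eq_swap_mul (swap i j), Equiv.swap_apply_right,
      Equiv.swap_apply_of_ne_of_ne hik.symm hjk.symm, Equiv.swap_comm i j]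
  rw [h.oddSwap_mul_expand hjk hik, hs]
  unfold oddSwap
  calc (1 + c k * c i) * s (swap i k) * ((1 + c i * c j) * s (swap j i))
      = (1 + c k * c i) * (s (swap i k) + s (swap i k) * (c i * c j)) * s (swap j i) := by
        noncomm_ring
    _ = (1 + c k * c j + c k * c i + c k * c i * (c k * c j)) *
          (s (swap i k) * s (swap j i)) := by rw [h1]; noncomm_ring
    _ = _ := by rw [e, map_mul]; noncomm_ring

theorem oddSwap_commute {i j k l : Fin n} (hij : i ≠ j) (hil : i ≠ l) (hkj : k ≠ j)
    (hkl : k ≠ l) : oddSwap c s i k * oddSwap c s j l = oddSwap c s j l * oddSwap c s i k := by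
  have h1 : s (swap i k) * oddSwap c s j l = oddSwap c s j l * s (swap i k) := by
    rw [h.perm_oddSwap, Equiv.swap_apply_of_ne_of_ne hij.symm hkj.symm,
      Equiv.swap_apply_of_ne_of_ne hil.symm hkl.symm]
  have h2 : c k * c i * oddSwap c s j l = oddSwap c s j l * (c k * c i) := by
    rw [mul_assoc, h.c_oddSwap_ne hij.symm hil.symm, ← mul_assoc,
      h.c_oddSwap_ne hkj.symm hkl.symm, mul_assoc]
  generalize oddSwap c s j l = O at *
  unfold oddSwap
  rw [mul_assoc, h1, ← mul_assoc, ← mul_assoc, add_mul, h2]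
  noncomm_ring

/-- Moving an odd generator through an odd transposition exchanges the two indices of the latter;
this is what makes the commutators of the `y i * x i` and of the Dunkl elements cancel. -/
theorem odd_mul_oddSwap {x : Fin n → R} (hx : IsOddFamily c s x) {i j : Fin n} (hij : i ≠ j) :
    x i * oddSwap c s j i = oddSwap c s i j * x j := by
  have h1 : s (swap i j) * x j = x i * s (swap i j) := by simp [hx.perm]
  have h2 : c j * c i * x i = x i * (c i * c j) := by
    rw [mul_assoc, hx.c_same, mul_neg, ← mul_assoc, hx.c_ne i j hij, mul_assoc,
      h.c_anticomm j i hij.symm, mul_neg, neg_neg]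
  unfold oddSwap
  rw [mul_assoc, h1, ← mul_assoc, ← mul_assoc, add_mul, h2, Equiv.swap_comm i j]
  noncomm_ring

end IsSergeevSystem

theorem IsOddFamily.oddSwap_mul {c : Fin n → R} {s : Equiv.Perm (Fin n) →* R}
    {x : Fin n → R} (hx : IsOddFamily c s x) {i j l : Fin n}
    (hil : i ≠ l) (hjl : j ≠ l) : oddSwap c s i j * x l = x l * oddSwap c s i j := by
  have h1 : s (swap i j) * x l = x l * s (swap i j) := by
    rw [hx.perm, Equiv.swap_apply_of_ne_of_ne hil.symm hjl.symm]
  have h2 : c j * c i * x l = x l * (c j * c i) := by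
    rw [mul_assoc, hx.c_ne l i hil.symm, ← mul_assoc, hx.c_ne l j hjl.symm, mul_assoc]
  unfold oddSwap
  rw [mul_assoc, h1, ← mul_assoc, ← mul_assoc, add_mul, h2]
  noncomm_ring

/-- The sum of the odd transpositions `oddSwap c s i k` over `k < i`. -/
def oddJucysMurphy (c : Fin n → R) (s : Equiv.Perm (Fin n) →* R) (i : Fin n) : R :=
  ∑ k ∈ Finset.Iio i, oddSwap c s i k

namespace IsSergeevSystem

variable {c : Fin n → R} {s : Equiv.Perm (Fin n) →* R} (h : IsSergeevSystem c s)
include h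

/-- `M_j` is fixed by the permutations that fix `j` and preserve the indices below `j`. -/
theorem perm_jucysMurphy {σ : Equiv.Perm (Fin n)} {j : Fin n} (hj : σ j = j)
    (hσ : ∀ k, k < j → σ k < j) :
    s σ * oddJucysMurphy c s j = oddJucysMurphy c s j * s σ := by
  unfold oddJucysMurphy
  rw [Finset.mul_sum, Finset.sum_mul]
  refine Finset.sum_bij (fun k _ => σ k) (fun k hk => ?_) (fun a _ b _ hab => σ.injective hab)
    ?_ (fun k hk => ?_)
  · simpa using hσ k (by simpa using hk)
  · have himg : (Finset.Iio j).image σ = Finset.Iio j := by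
      refine Finset.eq_of_subset_of_card_le (fun k hk => ?_) ?_
      · obtain ⟨a, ha, rfl⟩ := Finset.mem_image.1 hk
        simpa using hσ a (by simpa using ha)
      · rw [Finset.card_image_of_injective _ σ.injective]
    intro b hb
    rw [← himg] at hb
    obtain ⟨a, ha, rfl⟩ := Finset.mem_image.1 hb
    exact ⟨a, ha, rfl⟩
  · rw [h.perm_oddSwap, hj]

theorem c_jucysMurphy_same (i : Fin n) :
    c i * oddJucysMurphy c s i = -(oddJucysMurphy c s i * c i) := by
  unfold oddJucysMurphy
  rw [Finset.mul_sum, Finset.sum_mul, ← Finset.sum_neg_distrib]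
  exact Finset.sum_congr rfl fun k hk => h.c_oddSwap_left (Finset.mem_Iio.1 hk).ne'

theorem c_jucysMurphy_ne {i j : Fin n} (hij : i ≠ j) :
    c j * oddJucysMurphy c s i = oddJucysMurphy c s i * c j := by
  unfold oddJucysMurphy
  rw [Finset.mul_sum, Finset.sum_mul]
  refine Finset.sum_congr rfl fun k hk => ?_
  rcases eq_or_ne k j with rfl | hkj
  · exact h.c_oddSwap_right _ _
  · exact h.c_oddSwap_ne hij hkj

theorem oddSwap_jucysMurphy {k i j : Fin n} (hki : k < i) (hij : i < j) :
    oddSwap c s i k * oddJucysMurphy c s j = oddJucysMurphy c s j * oddSwap c s i k := by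
  have h1 : s (swap i k) * oddJucysMurphy c s j = oddJucysMurphy c s j * s (swap i k) := by
    refine h.perm_jucysMurphy
      (Equiv.swap_apply_of_ne_of_ne hij.ne' (hki.trans hij).ne') fun l hl => ?_
    rcases eq_or_ne l i with rfl | hli
    · simpa using hki.trans hij
    rcases eq_or_ne l k with rfl | hlk
    · simpa using hij
    · rwa [Equiv.swap_apply_of_ne_of_ne hli hlk]
  have h2 : c k * c i * oddJucysMurphy c s j = oddJucysMurphy c s j * (c k * c i) := by
    rw [mul_assoc, h.c_jucysMurphy_ne hij.ne', ← mul_assoc,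
      h.c_jucysMurphy_ne (hki.trans hij).ne', mul_assoc]
  unfold oddSwap
  rw [mul_assoc, h1, ← mul_assoc, add_mul, h2]
  noncomm_ring

theorem jucysMurphy_comm {i j : Fin n} (hij : i < j) :
    oddJucysMurphy c s i * oddJucysMurphy c s j =
      oddJucysMurphy c s j * oddJucysMurphy c s i := by
  conv_lhs => rw [oddJucysMurphy]
  conv_rhs => arg 2; rw [oddJucysMurphy]
  rw [Finset.mul_sum, Finset.sum_mul]
  exact Finset.sum_congr rfl fun k hk => h.oddSwap_jucysMurphy (Finset.mem_Iio.1 hk) hij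

theorem jucysMurphy_succ {i i' : Fin n} (hi : (i : ℕ) + 1 = i') :
    oddJucysMurphy c s i' * s (swap i i') - s (swap i i') * oddJucysMurphy c s i
      = 1 - c i' * c i := by
  have hlt : i < i' := by rw [Fin.lt_def]; omega
  have hI : Finset.Iio i' = insert i (Finset.Iio i) := by
    ext k; simp only [Finset.mem_Iio, Finset.mem_insert, Fin.lt_def, Fin.ext_iff]; omega
  have hsw : s (swap i' i) * s (swap i i') = 1 := by
    rw [← map_mul, Equiv.swap_comm i' i, Equiv.swap_mul_self, map_one]
  have h1 : s (swap i i') * oddJucysMurphy c s i =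
      ∑ k ∈ Finset.Iio i, oddSwap c s i' k * s (swap i i') := by
    rw [oddJucysMurphy, Finset.mul_sum]
    refine Finset.sum_congr rfl fun k hk => ?_
    have hk := Finset.mem_Iio.1 hk
    rw [h.perm_oddSwap, Equiv.swap_apply_left,
      Equiv.swap_apply_of_ne_of_ne hk.ne (hk.trans hlt).ne]
  rw [h1, oddJucysMurphy, hI, Finset.sum_insert (by simp), add_mul, Finset.sum_mul,
    add_sub_cancel_right, oddSwap, mul_assoc, hsw, mul_one, h.c_anticomm i i' hlt.ne]
  noncomm_ring

end IsSergeevSystem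

/-- The homomorphism from the free algebra that sends the generator `a_i` to `y_i x_i + M_i`. -/
noncomputable def affineFreeHom {n : ℕ} {R : Type*} [Ring R] [Algebra ℂ R] (c : Fin n → R)
    (s : Equiv.Perm (Fin n) →* R) (x y : Fin n → R) : FreeAlgebra ℂ (AffHCGen n) →ₐ[ℂ] R :=
  FreeAlgebra.lift ℂ fun g : AffHCGen n => match g with
    | .a i => y i * x i + oddJucysMurphy c s i
    | .c i => c i
    | .perm σ => s σ

namespace IsDAHCSystem

variable {c : Fin n → R} {s : Equiv.Perm (Fin n) →* R} {x y : Fin n → R}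
  (h : IsDAHCSystem c s x y)
include h

theorem oddSwap_y {i j l : Fin n} (hi : i ≠ l) (hj : j ≠ l) :
    oddSwap c s i j * y l = y l * oddSwap c s i j := by
  have h1 : s (swap i j) * y l = y l * s (swap i j) := by
    rw [h.perm_y, Equiv.swap_apply_of_ne_of_ne hi.symm hj.symm]
  have h2 : c j * c i * y l = y l * (c j * c i) := by
    rw [mul_assoc, h.c_y, ← mul_assoc, h.c_y, mul_assoc]
  unfold oddSwap
  rw [mul_assoc, h1, ← mul_assoc, ← mul_assoc, add_mul, h2]
  noncomm_ring

theorem oddSwap_y_right (i j : Fin n) : oddSwap c s i j * y j = y i * oddSwap c s i j := by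
  have h1 : s (swap i j) * y j = y i * s (swap i j) := by simp [h.perm_y]
  have h2 : c j * c i * y i = y i * (c j * c i) := by
    rw [mul_assoc, h.c_y, ← mul_assoc, h.c_y, mul_assoc]
  unfold oddSwap
  rw [mul_assoc, h1, ← mul_assoc, ← mul_assoc, add_mul, h2]
  noncomm_ring

theorem yx_jucysMurphy {i j : Fin n} (hij : i < j) :
    y j * x j * oddJucysMurphy c s i = oddJucysMurphy c s i * (y j * x j) := by
  unfold oddJucysMurphy
  rw [Finset.mul_sum, Finset.sum_mul]
  refine Finset.sum_congr rfl fun k hk => ?_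
  have hkj := (Finset.mem_Iio.1 hk).trans hij
  rw [← mul_assoc, h.oddSwap_y hij.ne hkj.ne, mul_assoc, mul_assoc,
    h.odd.oddSwap_mul hij.ne hkj.ne]

/-- Only the summand of `M_j` at the index `i` fails to commute with `y_i x_i`. -/
theorem yx_jucysMurphy_gt {i j : Fin n} (hij : i < j) :
    y i * x i * oddJucysMurphy c s j - oddJucysMurphy c s j * (y i * x i) =
      y i * x i * oddSwap c s j i - oddSwap c s j i * (y i * x i) := by
  unfold oddJucysMurphy
  rw [Finset.mul_sum, Finset.sum_mul, ← Finset.sum_sub_distrib,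
    Finset.sum_eq_single_of_mem i (Finset.mem_Iio.2 hij)]
  intro k hk hki
  rw [← mul_assoc _ (y i), h.oddSwap_y hij.ne' hki, mul_assoc, mul_assoc,
    h.odd.oddSwap_mul hij.ne' hki, sub_self]

/-- The elements `y i * x i + M i` commute. The commutator of `y i * x i` and `y j * x j` is
cancelled by that of `y i * x i` with the summand `oddSwap c s j i` of `M j`. -/
theorem affine_comm_of_lt {i j : Fin n} (hij : i < j) :
    (y i * x i + oddJucysMurphy c s i) * (y j * x j + oddJucysMurphy c s j) =
      (y j * x j + oddJucysMurphy c s j) * (y i * x i + oddJucysMurphy c s i) := by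
  have h1 := h.y_x_ne i j hij.ne
  have h2 := h.y_x_ne j i hij.ne'
  have h3 := h.yx_jucysMurphy_gt hij
  have h4 := h.yx_jucysMurphy hij
  have h5 := h.sergeev.jucysMurphy_comm hij
  have h6 := h.sergeev.odd_mul_oddSwap h.odd hij.ne
  have h7 := h.oddSwap_y_right j i
  have h8 : y i * x i * (y j * x j) - y j * x j * (y i * x i) =
      -(y i * oddSwap c s i j * x j) + y j * oddSwap c s j i * x i := by
    rw [← h1, ← h2]
    have e1 : y i * x i * (y j * x j) - y j * x j * (y i * x i) -
        (-(y i * (y j * x i - x i * y j) * x j) + y j * (y i * x j - x j * y i) * x i) =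
        y i * y j * (x i * x j) - y j * y i * (x j * x i) := by noncomm_ring
    rw [h.y_comm i j, h.odd.comm i j, sub_self, sub_eq_zero] at e1
    exact e1
  have h9 : y i * x i * oddSwap c s j i - oddSwap c s j i * (y i * x i) =
      y i * oddSwap c s i j * x j - y j * oddSwap c s j i * x i := by
    rw [mul_assoc, h6, ← mul_assoc, ← mul_assoc, h7]
  rw [← sub_eq_zero]
  calc _ = (y i * x i * (y j * x j) - y j * x j * (y i * x i)) +
        (y i * x i * oddJucysMurphy c s j - oddJucysMurphy c s j * (y i * x i)) -
        (y j * x j * oddJucysMurphy c s i - oddJucysMurphy c s i * (y j * x j)) +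
        (oddJucysMurphy c s i * oddJucysMurphy c s j -
          oddJucysMurphy c s j * oddJucysMurphy c s i) := by noncomm_ring
    _ = 0 := by rw [h3, h4, h5, h8, h9]; abel

theorem affine_comm (i j : Fin n) :
    (y i * x i + oddJucysMurphy c s i) * (y j * x j + oddJucysMurphy c s j) =
      (y j * x j + oddJucysMurphy c s j) * (y i * x i + oddJucysMurphy c s i) := by
  rcases lt_trichotomy i j with hij | rfl | hij
  · exact h.affine_comm_of_lt hij
  · rfl
  · exact (h.affine_comm_of_lt hij).symm

theorem perm_yx (σ : Equiv.Perm (Fin n)) (i : Fin n) :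
    s σ * (y i * x i) = y (σ i) * x (σ i) * s σ := by
  rw [← mul_assoc, h.perm_y, mul_assoc, h.odd.perm, mul_assoc]

theorem affine_rel [Algebra ℂ R] ⦃p q : FreeAlgebra ℂ (AffHCGen n)⦄ (hr : AffHCRel n p q) :
    affineFreeHom c s x y p = affineFreeHom c s x y q := by
  induction hr with
  | perm_one => simp [affineFreeHom, AffHCGen.S]
  | perm_mul σ τ => simp [affineFreeHom, AffHCGen.S]
  | perm_c σ i => simp [affineFreeHom, AffHCGen.S, AffHCGen.C, h.sergeev.perm_c]
  | c_sq i => simp [affineFreeHom, AffHCGen.C, h.sergeev.c_sq]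
  | c_anticomm i j hij => simpa [affineFreeHom, AffHCGen.C] using h.sergeev.c_anticomm i j hij
  | a_perm_ne i i' j hi h1 h2 =>
    simp only [affineFreeHom, AffHCGen.A, AffHCGen.S, map_mul, FreeAlgebra.lift_ι_apply]
    rw [mul_add, add_mul, h.perm_yx, Equiv.swap_apply_of_ne_of_ne h1 h2,
      h.sergeev.perm_jucysMurphy (Equiv.swap_apply_of_ne_of_ne h1 h2)]
    intro k hk
    have h1' := Fin.val_ne_of_ne h1
    have h2' := Fin.val_ne_of_ne h2
    rw [Equiv.swap_apply_def]
    split_ifs with e1 e2 <;> simp only [Fin.lt_def] at * <;> subst_vars <;> omega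
  | a_perm_succ i i' hi =>
    simp only [affineFreeHom, AffHCGen.A, AffHCGen.S, AffHCGen.C, map_mul, map_sub, map_one,
      FreeAlgebra.lift_ι_apply]
    rw [← h.sergeev.jucysMurphy_succ hi, mul_add, add_mul, h.perm_yx, Equiv.swap_apply_left]
    abel
  | c_a_same i =>
    simp only [affineFreeHom, AffHCGen.A, AffHCGen.C, map_mul, map_neg, FreeAlgebra.lift_ι_apply]
    rw [mul_add, add_mul, h.sergeev.c_jucysMurphy_same, ← mul_assoc, h.c_y, mul_assoc,
      h.odd.c_same]
    noncomm_ring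
  | a_comm i j =>
    simpa only [affineFreeHom, AffHCGen.A, map_mul, FreeAlgebra.lift_ι_apply]
      using h.affine_comm i j
  | c_a_ne i j hij =>
    simp only [affineFreeHom, AffHCGen.A, AffHCGen.C, map_mul, FreeAlgebra.lift_ι_apply]
    rw [mul_add, add_mul, h.sergeev.c_jucysMurphy_ne hij, ← mul_assoc, h.c_y, mul_assoc,
      h.odd.c_ne i j hij, mul_assoc]

/-- The homomorphism from the degenerate affine Hecke-Clifford algebra given by the elements `y i
* x i + M i`. -/
noncomputable def affineHom [Algebra ℂ R] : AffHC n →ₐ[ℂ] R :=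
  RingQuot.liftAlgHom ℂ ⟨affineFreeHom c s x y, h.affine_rel⟩

theorem affineHom_a [Algebra ℂ R] (i : Fin n) :
    h.affineHom (AffHC.a i) = y i * x i + oddJucysMurphy c s i := by
  simp [affineHom, affineFreeHom, AffHC.a, AffHCGen.A]

theorem affineHom_c [Algebra ℂ R] (i : Fin n) : h.affineHom (AffHC.c i) = c i := by
  simp [affineHom, affineFreeHom, AffHC.c, AffHCGen.C]

theorem affineHom_perm [Algebra ℂ R] (σ : Equiv.Perm (Fin n)) :
    h.affineHom (AffHC.perm σ) = s σ := by
  simp [affineHom, affineFreeHom, AffHC.perm, AffHCGen.S]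

end IsDAHCSystem

end Systems

/-! ### Dunkl elements from divided differences -/

section Model

variable {n : ℕ} {R : Type*} [Ring R]

/-- The relations between coordinates `y i`, permutations, and divided difference operators `Δ i k
= (1 - q (i k)) / (y i - y k)`: the operators `Δ i k` are antisymmetric, square to zero and
satisfy the classical Yang-Baxter equation `diff_cycle`. The convention is `Δ i i = 0`. -/
structure IsDividedDifferenceSystem (q : Equiv.Perm (Fin n) →* R) (y : Fin n → R)
    (Δ : Fin n → Fin n → R) : Prop where
  y_comm : ∀ i j, y i * y j = y j * y i
  perm_y : ∀ σ i, q σ * y i = y (σ i) * q σ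
  perm_diff : ∀ σ i k, q σ * Δ i k = Δ (σ i) (σ k) * q σ
  diff_self : ∀ i, Δ i i = 0
  diff_swap : ∀ i k, Δ k i = -Δ i k
  diff_sq : ∀ i k, Δ i k * Δ i k = 0
  diff_comm : ∀ i j k l, i ≠ j → i ≠ l → k ≠ j → k ≠ l → Δ i k * Δ j l = Δ j l * Δ i k
  diff_cycle : ∀ i j k, i ≠ j → j ≠ k → i ≠ k →
    Δ i j * Δ j k + Δ j k * Δ k i + Δ k i * Δ i j = 0
  y_diff : ∀ i j, i ≠ j → y j * Δ i j - Δ i j * y j = q (swap i j)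
  y_diff_ne : ∀ i j l, i ≠ l → j ≠ l → y l * Δ i j = Δ i j * y l

theorem oddSwap_commute_of {c : Fin n → R} {p : Equiv.Perm (Fin n) →* R} {b : R}
    (hc : ∀ i, Commute (c i) b) (hp : ∀ σ, Commute (p σ) b)
    (i k : Fin n) : Commute (oddSwap c p i k) b :=
  ((Commute.one_left b).add_left ((hc k).mul_left (hc i))).mul_left (hp _)

/-- Two commuting systems in one ring: Clifford generators `c`, permutations `p` and odd elements
`ξ` on one side, and coordinates `y`, permutations `q` and divided differences `Δ` on the other.
-/
structure IsModel (c : Fin n → R) (p : Equiv.Perm (Fin n) →* R) (ξ : Fin n → R)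
    (q : Equiv.Perm (Fin n) →* R) (y : Fin n → R) (Δ : Fin n → Fin n → R) : Prop where
  sergeev : IsSergeevSystem c p
  odd : IsOddFamily c p ξ
  divided : IsDividedDifferenceSystem q y Δ
  c_q : ∀ i σ, c i * q σ = q σ * c i
  c_y : ∀ i j, c i * y j = y j * c i
  c_diff : ∀ i j k, c i * Δ j k = Δ j k * c i
  p_q : ∀ ρ σ, p ρ * q σ = q σ * p ρ
  p_y : ∀ σ i, p σ * y i = y i * p σ
  p_diff : ∀ σ i k, p σ * Δ i k = Δ i k * p σ
  odd_q : ∀ i σ, ξ i * q σ = q σ * ξ i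
  odd_y : ∀ i j, ξ i * y j = y j * ξ i
  odd_diff : ∀ i j k, ξ i * Δ j k = Δ j k * ξ i

/-- The Dunkl element `ξ_i + ∑_k Δ_{ik} (1 + c_k c_i) p_{ik}`. The summand at `k = i` vanishes in
a model, where `Δ i i = 0`. -/
def dunkl (c : Fin n → R) (p : Equiv.Perm (Fin n) →* R) (ξ : Fin n → R)
    (Δ : Fin n → Fin n → R) (i : Fin n) : R :=
  ξ i + ∑ k, Δ i k * oddSwap c p i k

namespace IsModel

variable {c : Fin n → R} {p : Equiv.Perm (Fin n) →* R} {ξ : Fin n → R}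
    {q : Equiv.Perm (Fin n) →* R} {y : Fin n → R} {Δ : Fin n → Fin n → R}
    (h : IsModel c p ξ q y Δ)
include h

theorem oddSwap_diff (i k j l : Fin n) : Commute (oddSwap c p i k) (Δ j l) :=
  oddSwap_commute_of (fun a => h.c_diff a j l) (fun σ => h.p_diff σ j l) i k

theorem term_mul_term (i k j l : Fin n) :
    Δ i k * oddSwap c p i k * (Δ j l * oddSwap c p j l) =
      Δ i k * Δ j l * (oddSwap c p i k * oddSwap c p j l) :=
  (h.oddSwap_diff i k j l).mul_mul_mul_comm _ _

/-- The classical Yang-Baxter equation for the summands of the Dunkl elements. -/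
theorem term_cycle {i j k : Fin n} (hij : i ≠ j) (hjk : j ≠ k) (hik : i ≠ k) :
    ⁅Δ i j * oddSwap c p i j, Δ j k * oddSwap c p j k⁆ +
      ⁅Δ i k * oddSwap c p i k, Δ j i * oddSwap c p j i⁆ +
      ⁅Δ i k * oddSwap c p i k, Δ j k * oddSwap c p j k⁆ = 0 := by
  have a1 := h.sergeev.oddSwap_mul_rotate hij hjk hik
  have a2 := h.sergeev.oddSwap_mul_rotate' hij hjk hik
  have b1 := h.sergeev.oddSwap_mul_rotate hij.symm hik hjk
  have b2 := h.sergeev.oddSwap_mul_rotate' hij.symm hik hjk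
  have d1 := h.divided.diff_cycle i j k hij hjk hik
  have d2 := h.divided.diff_cycle k j i hjk.symm hij.symm hik.symm
  have e1 := h.divided.diff_swap i j
  have e2 := h.divided.diff_swap i k
  have e3 := h.divided.diff_swap j k
  simp only [Ring.lie_def, h.term_mul_term]
  rw [← a1, a2, ← b1, b2]
  rw [e2] at d1
  rw [e1, e3] at d2
  rw [e1]
  generalize oddSwap c p i j * oddSwap c p j k = P at *
  generalize oddSwap c p j i * oddSwap c p i k = Q at *
  have : (Δ i j * Δ j k + Δ j k * -Δ i k + -Δ i k * Δ i j) * P -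
    (-Δ j k * -Δ i j + -Δ i j * Δ i k + Δ i k * -Δ j k) * Q = 0 := by rw [d1, d2]; simp
  rw [← this]; noncomm_ring

/-- The sums of divided differences times odd transpositions commute. The nonzero commutators are
grouped by the third index `k`, and each group vanishes by `term_cycle`. -/
theorem sum_lie_term {i j : Fin n} (hij : i ≠ j) :
    ∑ k, ∑ l, ⁅Δ i k * oddSwap c p i k, Δ j l * oddSwap c p j l⁆ = 0 := by
  set H : Fin n → Fin n → R := fun k l => ⁅Δ i k * oddSwap c p i k, Δ j l * oddSwap c p j l⁆
    with hH
  have hi : ∀ l, H i l = 0 := fun l => by simp [hH, h.divided.diff_self, Ring.lie_def]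
  have hj : ∀ k, H k j = 0 := fun l => by simp [hH, h.divided.diff_self, Ring.lie_def]
  have hji : H j i = 0 := by
    simp only [hH, Ring.lie_def, h.term_mul_term]
    rw [h.divided.diff_swap i j]
    simp [h.divided.diff_sq]
  have hne : ∀ k l, k ≠ i → k ≠ j → l ≠ i → l ≠ j → k ≠ l → H k l = 0 := by
    intro k l h1 h2 h3 h4 h5
    simp only [hH, Ring.lie_def, h.term_mul_term]
    rw [h.divided.diff_comm i j k l hij h3.symm h2 h5,
      h.sergeev.oddSwap_commute hij h3.symm h2 h5, sub_self]
  -- Outside the lines `k = j`, `l = i` and `k = l` the index pairs `i, k` and `j, l` are disjoint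
  -- or one of them is degenerate, so `H` vanishes; at the intersections of these lines `H` vanishes
  -- as well, so nothing is counted twice.
  have hsplit : ∀ k l, H k l =
      (if k = j then H j l else 0) + (if l = i then H k i else 0) +
        (if k = l then H k k else 0) := by
    intro k l
    by_cases h1 : k = j <;> by_cases h2 : l = i <;> by_cases h3 : k = l <;>
      by_cases h4 : k = i <;> by_cases h5 : l = j <;> subst_vars <;>
      simp_all
  have hcyc : ∀ k, H j k + H k i + H k k = 0 := by
    intro k
    by_cases h1 : k = i
    · subst h1; simp [hi, hji]
    by_cases h2 : k = j
    · subst h2; simp [hj, hji]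
    exact h.term_cycle hij (Ne.symm h2) (Ne.symm h1)
  change ∑ k, ∑ l, H k l = 0
  rw [Finset.sum_congr rfl fun k _ => Finset.sum_congr rfl fun l _ => hsplit k l]
  simp_rw [Finset.sum_add_distrib]
  rw [Finset.sum_comm]
  simp only [Finset.sum_ite_eq, Finset.sum_ite_eq', Finset.mem_univ, if_true]
  rw [← Finset.sum_add_distrib, ← Finset.sum_add_distrib]
  exact Finset.sum_eq_zero fun k _ => hcyc k

/-- The terms of the commutator of two Dunkl elements that are linear in `ξ` cancel. -/
theorem lie_odd_sum (i j : Fin n) (hij : i ≠ j) :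
    ⁅ξ i, ∑ l, Δ j l * oddSwap c p j l⁆ + ⁅∑ k, Δ i k * oddSwap c p i k, ξ j⁆ = 0 := by
  have key : ∀ i j, i ≠ j → ⁅ξ i, ∑ l, Δ j l * oddSwap c p j l⁆ =
      Δ j i * ⁅ξ i, oddSwap c p j i⁆ := by
    intro i j hij
    rw [Ring.lie_def, Finset.mul_sum, Finset.sum_mul, ← Finset.sum_sub_distrib,
      Finset.sum_eq_single_of_mem i (Finset.mem_univ i)]
    · rw [← mul_assoc, h.odd_diff, Ring.lie_def, mul_sub, mul_assoc, mul_assoc]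
    · intro l _ hl
      rw [← mul_assoc, h.odd_diff, mul_assoc, mul_assoc, h.odd.oddSwap_mul hij.symm hl, sub_self]
  have a1 := h.sergeev.odd_mul_oddSwap h.odd hij
  have a2 := h.sergeev.odd_mul_oddSwap h.odd hij.symm
  have skew : ⁅∑ k, Δ i k * oddSwap c p i k, ξ j⁆ = -⁅ξ j, ∑ k, Δ i k * oddSwap c p i k⁆ := by
    simp only [Ring.lie_def, neg_sub]
  rw [skew, key i j hij, key j i hij.symm, h.divided.diff_swap i j]
  simp only [Ring.lie_def, a1, a2]
  noncomm_ring

theorem dunkl_comm (i j : Fin n) :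
    dunkl c p ξ Δ i * dunkl c p ξ Δ j = dunkl c p ξ Δ j * dunkl c p ξ Δ i := by
  rcases eq_or_ne i j with rfl | hij
  · rfl
  have h1 := h.lie_odd_sum i j hij
  have h2 := h.sum_lie_term hij
  have h3 : ⁅∑ k, Δ i k * oddSwap c p i k, ∑ l, Δ j l * oddSwap c p j l⁆ = 0 := by
    simp only [Ring.lie_def, Finset.sum_sub_distrib] at h2 ⊢
    rw [← h2, Finset.sum_mul_sum, Finset.sum_mul_sum,
      Finset.sum_comm (f := fun k l => Δ j l * _ * (Δ i k * _))]
  have h4 := h.odd.comm i j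
  unfold dunkl
  generalize ∑ k, Δ i k * oddSwap c p i k = a at *
  generalize ∑ k, Δ j k * oddSwap c p j k = b at *
  simp only [Ring.lie_def] at h1 h3
  rw [← sub_eq_zero]
  calc _ = (ξ i * ξ j - ξ j * ξ i) + (ξ i * b - b * ξ i + (a * ξ j - ξ j * a)) +
        (a * b - b * a) := by noncomm_ring
    _ = 0 := by rw [h1, h3, h4]; simp

theorem lie_y_term (i j l : Fin n) :
    y l * (Δ i j * oddSwap c p i j) - Δ i j * oddSwap c p i j * y l =
      (y l * Δ i j - Δ i j * y l) * oddSwap c p i j := by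
  have := oddSwap_commute_of (b := y l) (fun a => h.c_y a l) (fun σ => h.p_y σ l) i j
  rw [mul_assoc _ _ (y l), this.eq]
  noncomm_ring

variable {s : Equiv.Perm (Fin n) →* R} (hs : ∀ σ, s σ = p σ * q σ)
include hs

theorem q_mul_oddSwap (i j : Fin n) :
    q (swap i j) * oddSwap c p i j = oddSwap c s i j := by
  rw [oddSwap, oddSwap, hs, h.p_q, ← mul_assoc, ← mul_assoc]
  congr 1
  rw [mul_add, add_mul, ← mul_assoc, ← h.c_q, mul_assoc, ← h.c_q, ← mul_assoc]
  simp

theorem isSergeev : IsSergeevSystem c s where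
  perm_c σ i := by rw [hs, mul_assoc, ← h.c_q, ← mul_assoc, h.sergeev.perm_c, mul_assoc]
  c_sq := h.sergeev.c_sq
  c_anticomm := h.sergeev.c_anticomm

/-- In a model, the Dunkl elements together with the diagonal permutations `p σ * q σ` satisfy the
relations of the double affine Hecke-Clifford algebra. -/
theorem isDAHCSystem : IsDAHCSystem c s (dunkl c p ξ Δ) y where
  sergeev := h.isSergeev hs
  odd :=
    { comm := h.dunkl_comm
      perm := fun σ i => by
        have h1 : s σ * ξ i = ξ (σ i) * s σ := by
          rw [hs, mul_assoc, ← h.odd_q, ← mul_assoc, h.odd.perm, mul_assoc]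
        have h2 : ∀ k, s σ * (Δ i k * oddSwap c p i k) =
            Δ (σ i) (σ k) * oddSwap c p (σ i) (σ k) * s σ := by
          intro k
          have h3 := (oddSwap_commute_of (b := q σ) (fun a => h.c_q a σ)
            (fun ρ => h.p_q ρ σ) i k).eq
          calc s σ * (Δ i k * oddSwap c p i k)
              = p σ * (q σ * Δ i k) * oddSwap c p i k := by rw [hs]; noncomm_ring
            _ = p σ * Δ (σ i) (σ k) * (q σ * oddSwap c p i k) := by
                rw [h.divided.perm_diff]; noncomm_ring
            _ = Δ (σ i) (σ k) * (p σ * oddSwap c p i k) * q σ := by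
                rw [h.p_diff, ← h3]; noncomm_ring
            _ = _ := by rw [h.sergeev.perm_oddSwap, hs]; noncomm_ring
        rw [dunkl, dunkl, mul_add, add_mul, h1, Finset.mul_sum, Finset.sum_mul]
        congr 1
        rw [← Equiv.sum_comp σ fun k => Δ (σ i) k * oddSwap c p (σ i) k * s σ]
        exact Finset.sum_congr rfl fun k _ => h2 k
      c_same := fun i => by
        rw [dunkl, mul_add, add_mul, h.odd.c_same, Finset.mul_sum, Finset.sum_mul, neg_add,
          ← Finset.sum_neg_distrib]
        congr 1
        refine Finset.sum_congr rfl fun k _ => ?_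
        rcases eq_or_ne i k with rfl | hik
        · simp [h.divided.diff_self]
        · rw [← mul_assoc, h.c_diff, mul_assoc, h.sergeev.c_oddSwap_left hik, mul_neg, mul_assoc]
      c_ne := fun i j hij => by
        rw [dunkl, mul_add, add_mul, h.odd.c_ne i j hij, Finset.mul_sum, Finset.sum_mul]
        congr 1
        refine Finset.sum_congr rfl fun k _ => ?_
        rw [← mul_assoc, h.c_diff, mul_assoc, mul_assoc]
        rcases eq_or_ne k j with rfl | hkj
        · rw [h.sergeev.c_oddSwap_right]
        · rw [h.sergeev.c_oddSwap_ne hij hkj] }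
  y_comm := h.divided.y_comm
  perm_y σ i := by rw [hs, mul_assoc, h.divided.perm_y, ← mul_assoc, h.p_y, mul_assoc]
  c_y i j := h.c_y j i
  y_x_ne i j hij := by
    rw [dunkl, mul_add, add_mul, add_sub_add_comm, h.odd_y, sub_self, zero_add, Finset.mul_sum,
      Finset.sum_mul, ← Finset.sum_sub_distrib,
      Finset.sum_eq_single_of_mem j (Finset.mem_univ j), h.lie_y_term, h.divided.y_diff i j hij,
      h.q_mul_oddSwap hs]
    intro k _ hk
    rw [h.lie_y_term, h.divided.y_diff_ne i k j hij hk, sub_self, zero_mul]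
  y_x_same i := by
    rw [dunkl, mul_add, add_mul, add_sub_add_comm, h.odd_y, sub_self, zero_add, Finset.mul_sum,
      Finset.sum_mul, ← Finset.sum_sub_distrib, ← Finset.sum_neg_distrib,
      ← Finset.sum_erase _ (a := i) (by simp [h.divided.diff_self])]
    refine Finset.sum_congr rfl fun k hk => ?_
    have hk := Finset.ne_of_mem_erase hk
    have h1 := h.divided.y_diff k i hk
    have h2 : y i * Δ i k - Δ i k * y i = - q (swap i k) := by
      rw [h.divided.diff_swap k i, Equiv.swap_comm i k, ← h1]; noncomm_ring
    rw [h.lie_y_term, h2, neg_mul, h.q_mul_oddSwap hs]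

end IsModel
end Model

/-! ### Jordan-Wigner signs -/

section JordanWigner

variable {n : ℕ}

/-- Flip the `j`-th bit. -/
def flipAt (j : Fin n) (t : Fin n → Bool) : Fin n → Bool := Function.update t j (!t j)

theorem flipAt_self (j : Fin n) (t : Fin n → Bool) : flipAt j t j = !t j := by simp [flipAt]

theorem flipAt_ne {j k : Fin n} (h : k ≠ j) (t : Fin n → Bool) : flipAt j t k = t k := by
  simp [flipAt, h]

theorem flipAt_flipAt (j : Fin n) (t : Fin n → Bool) : flipAt j (flipAt j t) = t := by
  ext k
  rcases eq_or_ne k j with rfl | h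
  · simp [flipAt_self]
  · simp [flipAt_ne h]

theorem flipAt_comm (j k : Fin n) (t : Fin n → Bool) :
    flipAt j (flipAt k t) = flipAt k (flipAt j t) := by
  rcases eq_or_ne j k with rfl | hjk
  · rfl
  ext l
  rcases eq_or_ne l j with rfl | h
  · simp [flipAt_self, flipAt_ne hjk]
  · rcases eq_or_ne l k with rfl | h'
    · simp [flipAt_self, flipAt_ne hjk.symm]
    · simp [flipAt_ne h, flipAt_ne h']

/-- The sign `(-1)^b`. -/
noncomputable def boolSign (b : Bool) : ℂ := if b then -1 else 1

theorem boolSign_mul_self (b : Bool) : boolSign b * boolSign b = 1 := by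
  cases b <;> simp [boolSign]

theorem boolSign_not (b : Bool) : boolSign (!b) = -boolSign b := by
  cases b <;> simp [boolSign]

theorem boolSign_ne_zero (b : Bool) : boolSign b ≠ 0 := by
  cases b <;> simp [boolSign]

/-- The Jordan-Wigner sign: the parity of the bits of `t` strictly below `j`. -/
noncomputable def jwSign (j : Fin n) (t : Fin n → Bool) : ℂ := ∏ k ∈ Finset.Iio j, boolSign (t k)

theorem jwSign_mul_self (j : Fin n) (t : Fin n → Bool) : jwSign j t * jwSign j t = 1 := by
  simp [jwSign, ← Finset.prod_mul_distrib, boolSign_mul_self]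

theorem jwSign_ne_zero (j : Fin n) (t : Fin n → Bool) : jwSign j t ≠ 0 :=
  Finset.prod_ne_zero_iff.2 fun _ _ => boolSign_ne_zero _

theorem jwSign_flipAt_of_le {j k : Fin n} (h : j ≤ k) (t : Fin n → Bool) :
    jwSign j (flipAt k t) = jwSign j t :=
  Finset.prod_congr rfl fun l hl => by
    rw [flipAt_ne ((Finset.mem_Iio.1 hl).trans_le h).ne]

theorem jwSign_flipAt_of_lt {j k : Fin n} (h : k < j) (t : Fin n → Bool) :
    jwSign j (flipAt k t) = -jwSign j t := by
  have hk : k ∈ Finset.Iio j := Finset.mem_Iio.2 h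
  rw [jwSign, jwSign, ← Finset.mul_prod_erase _ _ hk, ← Finset.mul_prod_erase _ _ hk,
    flipAt_self, boolSign_not, neg_mul]
  congr 2
  exact Finset.prod_congr rfl fun l hl => by rw [flipAt_ne (Finset.ne_of_mem_erase hl)]

theorem jwSign_anticomm {j k : Fin n} (h : j ≠ k) (t : Fin n → Bool) :
    jwSign j t * jwSign k (flipAt j t) = -(jwSign k t * jwSign j (flipAt k t)) := by
  rcases lt_or_gt_of_ne h with h | h
  · rw [jwSign_flipAt_of_lt h, jwSign_flipAt_of_le h.le]; ring
  · rw [jwSign_flipAt_of_lt h, jwSign_flipAt_of_le h.le]; ring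

end JordanWigner

/-! ### A model on functions -/

section WeightedShift

variable {I K : Type*} [CommRing K] [Algebra ℂ K]

/-- The operator `v ↦ (i ↦ a i * v (f i))` on functions: pullback along `f`, then multiplication
by `a`. -/
def weightedShift (a : I → K) (f : I → I) : Module.End ℂ (I → K) where
  toFun v i := a i * v (f i)
  map_add' v w := by ext i; simp [mul_add]
  map_smul' r v := by ext i; simp

@[simp] theorem weightedShift_apply (a : I → K) (f : I → I) (v : I → K) (i : I) :
    weightedShift a f v i = a i * v (f i) := rfl

end WeightedShift

namespace DunklModel

open MvPolynomial (X C)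

variable {n : ℕ}

/-- Basis labels of the model: a point `τ` of the regular orbit on which the `y i` and divided
differences act, a point `ρ` of the orbit on which the `c i` and `ξ i` act, and a vector of bits
for the Fock space of the Clifford algebra. -/
abbrev Index (n : ℕ) : Type := Equiv.Perm (Fin n) × Equiv.Perm (Fin n) × (Fin n → Bool)

/-- The space of the model. The polynomial variables record the action of the elements `ξ i`, so
that the degree in them can be used to find leading terms. -/
abbrev Space (n : ℕ) : Type := Index n → MvPolynomial (Fin n) ℂ

/-- Distinct nonzero values for the coordinates `y`. Distinctness gives divided differences, and
nonvanishing makes the leading term `y_i ξ_i` of `y_i x_i` injective. -/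
noncomputable def node (j : Fin n) : ℂ := (j : ℂ) + 1

theorem node_ne_zero (j : Fin n) : node j ≠ 0 := by
  exact Nat.cast_add_one_ne_zero (R := ℂ) (j : ℕ)

theorem node_sub_ne_zero {j k : Fin n} (h : j ≠ k) : node j - node k ≠ 0 := by
  rw [sub_ne_zero]
  intro e
  apply h
  simp only [node, add_left_inj] at e
  exact Fin.ext (by exact_mod_cast e)

/-- The Clifford generator `c_j`, in the Jordan-Wigner form, at the index `ρ⁻¹ j`. -/
noncomputable def opC (j : Fin n) : Module.End ℂ (Space n) :=
  weightedShift (fun i => C (jwSign (i.2.1⁻¹ j) i.2.2))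
    (fun i => (i.1, i.2.1, flipAt (i.2.1⁻¹ j) i.2.2))

/-- The odd element `ξ_j`: multiplication by the variable of index `ρ⁻¹ j`, with the sign that
makes it anticommute with `c_j`. -/
noncomputable def opXi (j : Fin n) : Module.End ℂ (Space n) :=
  weightedShift (fun i => C (boolSign (i.2.2 (i.2.1⁻¹ j))) * X (i.2.1⁻¹ j)) id

/-- Permutations acting on the second orbit only. -/
noncomputable def opP : Equiv.Perm (Fin n) →* Module.End ℂ (Space n) where
  toFun σ := weightedShift 1 (fun i => (i.1, σ⁻¹ * i.2.1, i.2.2))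
  map_one' := by ext; simp
  map_mul' σ τ := by ext; simp [mul_assoc]

/-- Permutations acting on the first orbit only. -/
noncomputable def opQ : Equiv.Perm (Fin n) →* Module.End ℂ (Space n) where
  toFun σ := weightedShift 1 (fun i => (σ⁻¹ * i.1, i.2))
  map_one' := by ext; simp
  map_mul' σ τ := by ext; simp [mul_assoc]

/-- Permutations acting diagonally on both orbits; these represent the symmetric group of the
double affine Hecke-Clifford algebra. -/
noncomputable def opS : Equiv.Perm (Fin n) →* Module.End ℂ (Space n) where
  toFun σ := weightedShift 1 (fun i => (σ⁻¹ * i.1, σ⁻¹ * i.2.1, i.2.2))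
  map_one' := by ext; simp
  map_mul' σ τ := by ext; simp [mul_assoc]

/-- The coordinate `y_j`, which takes the value `node (τ⁻¹ j)` at the point `τ`. -/
noncomputable def opY (j : Fin n) : Module.End ℂ (Space n) :=
  weightedShift (fun i => C (node (i.1⁻¹ j))) id

/-- The divided difference in the coordinates `j` and `k`. It is zero for `j = k`, since `0⁻¹ =
0`. -/
noncomputable def opDiff (j k : Fin n) : Module.End ℂ (Space n) :=
  weightedShift (fun i => C (node (i.1⁻¹ j) - node (i.1⁻¹ k))⁻¹) id -
    weightedShift (fun i => C (node (i.1⁻¹ j) - node (i.1⁻¹ k))⁻¹)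
      (fun i => (swap j k * i.1, i.2))

theorem opC_apply (j : Fin n) (v : Space n) (i : Index n) :
    opC j v i = C (jwSign (i.2.1⁻¹ j) i.2.2) * v (i.1, i.2.1, flipAt (i.2.1⁻¹ j) i.2.2) := rfl

theorem opXi_apply (j : Fin n) (v : Space n) (i : Index n) :
    opXi j v i = C (boolSign (i.2.2 (i.2.1⁻¹ j))) * X (i.2.1⁻¹ j) * v i := rfl

theorem opP_apply (σ : Equiv.Perm (Fin n)) (v : Space n) (i : Index n) :
    opP σ v i = v (i.1, σ⁻¹ * i.2.1, i.2.2) := one_mul _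

theorem opQ_apply (σ : Equiv.Perm (Fin n)) (v : Space n) (i : Index n) :
    opQ σ v i = v (σ⁻¹ * i.1, i.2) := one_mul _

theorem opS_apply (σ : Equiv.Perm (Fin n)) (v : Space n) (i : Index n) :
    opS σ v i = v (σ⁻¹ * i.1, σ⁻¹ * i.2.1, i.2.2) := one_mul _

theorem opY_apply (j : Fin n) (v : Space n) (i : Index n) :
    opY j v i = C (node (i.1⁻¹ j)) * v i := rfl

theorem opDiff_apply (j k : Fin n) (v : Space n) (i : Index n) :
    opDiff j k v i = C (node (i.1⁻¹ j) - node (i.1⁻¹ k))⁻¹ *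
      (v i - v (swap j k * i.1, i.2)) := by
  rw [mul_sub]; rfl

theorem op_ext {S T : Module.End ℂ (Space n)} (h : ∀ v i, S v i = T v i) : S = T :=
  LinearMap.ext fun v => funext (h v)

theorem isSergeev : IsSergeevSystem (opC (n := n)) opP where
  perm_c σ j := op_ext fun v i => by simp [opC_apply, opP_apply]
  c_sq j := op_ext fun v i => by
    simp only [Module.End.mul_apply, opC_apply, flipAt_flipAt, Module.End.one_apply]
    rw [← mul_assoc, ← map_mul, jwSign_flipAt_of_le le_rfl, jwSign_mul_self, map_one, one_mul]
  c_anticomm j k hjk := op_ext fun v i => by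
    have := jwSign_anticomm (i.2.1⁻¹.injective.ne hjk) i.2.2
    simp only [Module.End.mul_apply, opC_apply, LinearMap.neg_apply, Pi.neg_apply]
    rw [← mul_assoc, ← mul_assoc, ← map_mul, ← map_mul, this, flipAt_comm]
    simp

theorem isOdd : IsOddFamily (opC (n := n)) opP opXi where
  comm j k := op_ext fun v i => by simp only [Module.End.mul_apply, opXi_apply]; ring
  perm σ j := op_ext fun v i => by simp [opXi_apply, opP_apply]
  c_same j := op_ext fun v i => by
    simp only [Module.End.mul_apply, opC_apply, opXi_apply, LinearMap.neg_apply, Pi.neg_apply,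
      flipAt_self, boolSign_not, map_neg]
    ring
  c_ne j k hjk := op_ext fun v i => by
    simp only [Module.End.mul_apply, opC_apply, opXi_apply,
      flipAt_ne (i.2.1⁻¹.injective.ne hjk)]
    ring

theorem isDivided : IsDividedDifferenceSystem (opQ (n := n)) opY opDiff where
  y_comm j k := op_ext fun v i => by simp only [Module.End.mul_apply, opY_apply]; ring
  perm_y σ j := op_ext fun v i => by simp [opY_apply, opQ_apply]
  perm_diff σ j k := op_ext fun v i => by
    have : swap j k * (σ⁻¹ * i.1) = σ⁻¹ * (swap (σ j) (σ k) * i.1) := by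
      rw [← mul_assoc, ← mul_assoc, Equiv.mul_swap_eq_swap_mul]; simp
    simp [opDiff_apply, opQ_apply, this]
  diff_self j := op_ext fun v i => by simp [opDiff_apply]
  diff_swap j k := op_ext fun v i => by
    rw [LinearMap.neg_apply, Pi.neg_apply, opDiff_apply, opDiff_apply, Equiv.swap_comm k j,
      ← neg_sub (node (i.1⁻¹ j)), inv_neg, map_neg, neg_mul]
  diff_sq j k := op_ext fun v i => by
    simp only [Module.End.mul_apply, opDiff_apply, mul_inv_rev, Equiv.swap_inv,
      Equiv.Perm.mul_apply, Equiv.swap_apply_left, Equiv.swap_apply_right, ← mul_assoc (swap j k),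
      Equiv.swap_mul_self, one_mul, LinearMap.zero_apply, Pi.zero_apply]
    rw [← neg_sub (node (i.1⁻¹ j)), inv_neg, map_neg]
    ring
  diff_comm j k l m h1 h2 h3 h4 := op_ext fun v i => by
    have e : swap j l * swap k m = swap k m * swap j l := by
      rw [Equiv.mul_swap_eq_swap_mul, Equiv.swap_apply_of_ne_of_ne h1.symm h3.symm,
        Equiv.swap_apply_of_ne_of_ne h2.symm h4.symm]
    simp [opDiff_apply, ← mul_assoc (swap j l), ← mul_assoc (swap k m), e,
      Equiv.swap_apply_of_ne_of_ne h1 h2, Equiv.swap_apply_of_ne_of_ne h3 h4,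
      Equiv.swap_apply_of_ne_of_ne h1.symm h3.symm, Equiv.swap_apply_of_ne_of_ne h2.symm h4.symm]
    ring
  diff_cycle j k l hjk hkl hjl := op_ext fun v i => by
    have e1 : swap k l * swap j k = swap j k * swap j l := by
      rw [Equiv.mul_swap_eq_swap_mul (swap j k), Equiv.swap_apply_left,
        Equiv.swap_apply_of_ne_of_ne hjl.symm hkl.symm]
    have e2 : swap l j * swap k l = swap j k * swap j l := by
      rw [Equiv.mul_swap_eq_swap_mul (swap l j), Equiv.swap_apply_left,
        Equiv.swap_apply_of_ne_of_ne hkl hjk.symm, Equiv.swap_comm k j, Equiv.swap_comm l j]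
    have a1 := node_sub_ne_zero (i.1⁻¹.injective.ne hjk)
    have a2 := node_sub_ne_zero (i.1⁻¹.injective.ne hkl)
    have a3 := node_sub_ne_zero (i.1⁻¹.injective.ne hjl.symm)
    simp only [Module.End.mul_apply, LinearMap.add_apply, Pi.add_apply, opDiff_apply, mul_inv_rev,
      Equiv.swap_inv, Equiv.Perm.mul_apply, Equiv.swap_apply_right,
      Equiv.swap_apply_of_ne_of_ne hjl.symm hkl.symm, Equiv.swap_apply_of_ne_of_ne hjk hjl,
      Equiv.swap_apply_of_ne_of_ne hkl hjk.symm,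
      ← mul_assoc (swap k l), ← mul_assoc (swap j k), ← mul_assoc (swap l j), e1, e2,
      LinearMap.zero_apply, Pi.zero_apply]
    rw [Equiv.swap_comm l j]
    generalize node (i.1⁻¹ j) = a at *
    generalize node (i.1⁻¹ k) = b at *
    generalize node (i.1⁻¹ l) = c at *
    -- The partial fraction identity behind the classical Yang-Baxter equation.
    have key : (a - b)⁻¹ * (b - c)⁻¹ + (b - c)⁻¹ * (c - a)⁻¹ + (c - a)⁻¹ * (a - b)⁻¹ = 0 := by
      field_simp; ring
    have key' := congrArg (C (σ := Fin n)) key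
    simp only [map_add, map_mul, map_zero] at key'
    rw [← neg_sub c a, ← neg_sub a b, ← neg_sub b c]
    simp only [inv_neg, map_neg]
    linear_combination (v i - v (swap j k * swap j l * i.1, i.2)) * key'
  y_diff j k hjk := op_ext fun v i => by
    have a1 := node_sub_ne_zero (i.1⁻¹.injective.ne hjk)
    simp only [Module.End.mul_apply, LinearMap.sub_apply, Pi.sub_apply, opDiff_apply, opY_apply,
      opQ_apply, mul_inv_rev, Equiv.swap_inv, Equiv.Perm.mul_apply, Equiv.swap_apply_right]
    have key := congrArg (C (σ := Fin n)) (inv_mul_cancel₀ a1)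
    rw [map_mul, map_sub, map_one] at key
    linear_combination v (swap j k * i.1, i.2) * key
  y_diff_ne j k l h1 h2 := op_ext fun v i => by
    simp [opDiff_apply, opY_apply, Equiv.swap_apply_of_ne_of_ne h1.symm h2.symm]
    ring

theorem isModel : IsModel (opC (n := n)) opP opXi opQ opY opDiff where
  sergeev := isSergeev
  odd := isOdd
  divided := isDivided
  c_q j σ := op_ext fun v i => by simp [opC_apply, opQ_apply]
  c_y j k := op_ext fun v i => by simp [opC_apply, opY_apply]; ring
  c_diff j k l := op_ext fun v i => by simp [opC_apply, opDiff_apply]; ring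
  p_q ρ σ := op_ext fun v i => by simp [opP_apply, opQ_apply]
  p_y σ j := op_ext fun v i => by simp [opP_apply, opY_apply]
  p_diff σ j k := op_ext fun v i => by simp [opP_apply, opDiff_apply]
  odd_q j σ := op_ext fun v i => by simp [opXi_apply, opQ_apply]
  odd_y j k := op_ext fun v i => by simp [opXi_apply, opY_apply]; ring
  odd_diff j k l := op_ext fun v i => by simp [opXi_apply, opDiff_apply]; ring

theorem opS_eq (σ : Equiv.Perm (Fin n)) : opS σ = opP σ * opQ σ :=
  op_ext fun v i => by simp [opS_apply, opP_apply, opQ_apply]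

theorem isDAHCSystem : IsDAHCSystem (opC (n := n)) opS (dunkl opC opP opXi opDiff) opY :=
  isModel.isDAHCSystem opS_eq

end DunklModel

/-! ### Spanning monomials in the affine algebra -/

section Stabilizer

variable {A V : Type*} [Ring A] [Algebra ℂ A] [AddCommGroup V] [Module ℂ V] [Module A V]
  [IsScalarTower ℂ A V]

/-- The subalgebra of the elements that map the subspace `M` to itself. -/
def stabilizerSubalgebra (A : Type*) [Ring A] [Algebra ℂ A] [Module A V] [IsScalarTower ℂ A V]
    (M : Submodule ℂ V) : Subalgebra ℂ A where
  carrier := {a | ∀ m ∈ M, a • m ∈ M}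
  mul_mem' ha hb m hm := by rw [mul_smul]; exact ha _ (hb _ hm)
  add_mem' ha hb m hm := by rw [add_smul]; exact M.add_mem (ha _ hm) (hb _ hm)
  algebraMap_mem' r m hm := by rw [algebraMap_smul]; exact M.smul_mem r hm

theorem mem_stabilizerSubalgebra_span {S : Set A} {a : A} :
    a ∈ stabilizerSubalgebra A (Submodule.span ℂ S) ↔
      ∀ m ∈ S, a * m ∈ Submodule.span ℂ S := by
  refine ⟨fun h m hm => h m (Submodule.subset_span hm), fun h m hm => ?_⟩
  induction hm using Submodule.span_induction with
  | mem m hm => exact h m hm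
  | zero => rw [smul_zero]; exact Submodule.zero_mem _
  | add x y _ _ hx hy => rw [smul_add]; exact Submodule.add_mem _ hx hy
  | smul r x _ hx => rw [smul_comm]; exact Submodule.smul_mem _ r hx

end Stabilizer

section CliffordWord

variable {n : ℕ} {R : Type*} [Ring R]

/-- The product of the `c j` with `t j = true`, in the order of the list `l`. -/
def cliffordWord (c : Fin n → R) (l : List (Fin n)) (t : Fin n → Bool) : R :=
  (l.map fun j => if t j then c j else 1).prod

theorem cliffordWord_cons (c : Fin n → R) (j : Fin n) (l : List (Fin n)) (t : Fin n → Bool) :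
    cliffordWord c (j :: l) t = (if t j then c j else 1) * cliffordWord c l t := by
  simp [cliffordWord]

theorem cliffordWord_flipAt_of_notMem (c : Fin n → R) {l : List (Fin n)} {i : Fin n} (hi : i ∉ l)
    (t : Fin n → Bool) : cliffordWord c l (flipAt i t) = cliffordWord c l t := by
  unfold cliffordWord
  congr 1
  refine List.map_congr_left fun j hj => ?_
  rw [flipAt_ne]
  rintro rfl
  exact hi hj

theorem IsSergeevSystem.c_mul_cliffordWord {c : Fin n → R} {s : Equiv.Perm (Fin n) →* R}
    (h : IsSergeevSystem c s) {l : List (Fin n)} (hl : l.Nodup) {i : Fin n} (hi : i ∈ l)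
    (t : Fin n → Bool) :
    c i * cliffordWord c l t = cliffordWord c l (flipAt i t) ∨
      c i * cliffordWord c l t = -cliffordWord c l (flipAt i t) := by
  induction l with
  | nil => simp at hi
  | cons j l ih =>
    rw [List.nodup_cons] at hl
    rw [cliffordWord_cons, cliffordWord_cons]
    rcases eq_or_ne i j with rfl | hij
    · left
      rw [cliffordWord_flipAt_of_notMem c hl.1, flipAt_self, ← mul_assoc]
      cases t i <;> simp [h.c_sq]
    · have hi' : i ∈ l := by simpa [hij] using hi
      rw [flipAt_ne hij.symm, ← mul_assoc]
      have h1 : c i * (if t j then c j else 1) = (if t j then c j else 1) * c i ∨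
          c i * (if t j then c j else 1) = -((if t j then c j else 1) * c i) := by
        cases t j
        · simp
        · right; simpa using h.c_anticomm i j hij
      generalize (if t j then c j else 1) = d at *
      rcases h1 with h1 | h1 <;> rcases ih hl.2 hi' with h2 | h2 <;> rw [h1] <;>
        simp [mul_assoc, h2]

theorem IsSergeevSystem.perm_mul_cliffordWord {c : Fin n → R} {s : Equiv.Perm (Fin n) →* R}
    (h : IsSergeevSystem c s) (σ : Equiv.Perm (Fin n)) (l : List (Fin n)) (t : Fin n → Bool) :
    s σ * cliffordWord c l t = cliffordWord (fun j => c (σ j)) l t * s σ := by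
  induction l with
  | nil => simp [cliffordWord]
  | cons j l ih =>
    rw [cliffordWord_cons, cliffordWord_cons, mul_assoc, ← ih, ← mul_assoc, ← mul_assoc]
    cases t j <;> simp [h.perm_c]

end CliffordWord

/-- The relations of the degenerate affine Hecke-Clifford algebra, for elements of an arbitrary
ring. -/
structure IsAffineSystem {n : ℕ} {A : Type*} [Ring A] (c : Fin n → A)
    (s : Equiv.Perm (Fin n) →* A) (a : Fin n → A) : Prop where
  sergeev : IsSergeevSystem c s
  a_comm : ∀ i j, a i * a j = a j * a i
  a_perm_ne : ∀ i i' j : Fin n, (i : ℕ) + 1 = i' → j ≠ i → j ≠ i' →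
    a j * s (swap i i') = s (swap i i') * a j
  a_perm_succ : ∀ i i' : Fin n, (i : ℕ) + 1 = i' →
    a i' * s (swap i i') - s (swap i i') * a i = 1 - c i' * c i
  c_a_same : ∀ i, c i * a i = -(a i * c i)
  c_a_ne : ∀ i j, i ≠ j → c j * a i = a i * c j

section Spanning

variable {n : ℕ} {A : Type*} [Ring A] [Algebra ℂ A]

/-- The Clifford monomial with exponents `t`, times a permutation. -/
def sergeevMonomial (c : Fin n → A) (s : Equiv.Perm (Fin n) →* A) (t : Fin n → Bool)
    (σ : Equiv.Perm (Fin n)) : A :=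
  cliffordWord c (List.finRange n) t * s σ

/-- The span of the Sergeev monomials. In a Sergeev system it is the subalgebra generated by the
`c i` and the permutations. -/
def sergeevSpan (c : Fin n → A) (s : Equiv.Perm (Fin n) →* A) : Submodule ℂ A :=
  Submodule.span ℂ (Set.range fun x : (Fin n → Bool) × Equiv.Perm (Fin n) =>
    sergeevMonomial c s x.1 x.2)

/-- The span of `1` and the elements `a i`. -/
def degreeOne (a : Fin n → A) : Submodule ℂ A :=
  Submodule.span ℂ (insert 1 (Set.range a))

/-- A word in the elements `a i`, times a Sergeev monomial. -/
def pbwMonomial (c : Fin n → A) (s : Equiv.Perm (Fin n) →* A) (a : Fin n → A)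
    (L : List (Fin n)) (t : Fin n → Bool) (σ : Equiv.Perm (Fin n)) : A :=
  (L.map a).prod * sergeevMonomial c s t σ

/-- The span of the monomials `pbwMonomial`, over all words. -/
def pbwSpan (c : Fin n → A) (s : Equiv.Perm (Fin n) →* A) (a : Fin n → A) : Submodule ℂ A :=
  Submodule.span ℂ (Set.range fun x : List (Fin n) × (Fin n → Bool) × Equiv.Perm (Fin n) =>
    pbwMonomial c s a x.1 x.2.1 x.2.2)

variable {c : Fin n → A} {s : Equiv.Perm (Fin n) →* A} {a : Fin n → A}

theorem sergeevMonomial_mem (t : Fin n → Bool) (σ : Equiv.Perm (Fin n)) :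
    sergeevMonomial c s t σ ∈ sergeevSpan c s := Submodule.subset_span ⟨(t, σ), rfl⟩

theorem perm_mem_sergeevSpan (σ : Equiv.Perm (Fin n)) : s σ ∈ sergeevSpan c s := by
  simpa [sergeevMonomial, cliffordWord] using
    sergeevMonomial_mem (c := c) (s := s) (fun _ => false) σ

theorem one_mem_sergeevSpan : (1 : A) ∈ sergeevSpan c s := by
  simpa using perm_mem_sergeevSpan (c := c) (s := s) 1

theorem IsSergeevSystem.c_mem_stabilizer_sergeevSpan (hS : IsSergeevSystem c s) (i : Fin n) :
    c i ∈ stabilizerSubalgebra A (sergeevSpan c s) := by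
  refine mem_stabilizerSubalgebra_span.2 ?_
  rintro _ ⟨⟨t, σ⟩, rfl⟩
  have hm := sergeevMonomial_mem (c := c) (s := s) (flipAt i t) σ
  simp only [sergeevMonomial] at hm ⊢
  rw [← mul_assoc]
  rcases hS.c_mul_cliffordWord (List.nodup_finRange n) (List.mem_finRange i) t with h | h
  · rw [h]; exact hm
  · rw [h, neg_mul]; exact Submodule.neg_mem _ hm

theorem IsSergeevSystem.perm_mem_stabilizer_sergeevSpan (hS : IsSergeevSystem c s)
    (σ : Equiv.Perm (Fin n)) :
    s σ ∈ stabilizerSubalgebra A (sergeevSpan c s) := by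
  refine mem_stabilizerSubalgebra_span.2 ?_
  rintro _ ⟨⟨t, τ⟩, rfl⟩
  simp only [sergeevMonomial]
  rw [← mul_assoc, hS.perm_mul_cliffordWord, mul_assoc, ← map_mul]
  have : cliffordWord (fun j => c (σ j)) (List.finRange n) t ∈
      stabilizerSubalgebra A (sergeevSpan c s) := by
    refine Subalgebra.list_prod_mem _ fun x hx => ?_
    obtain ⟨j, _, rfl⟩ := List.mem_map.1 hx
    cases t j
    · simp
    · simpa using hS.c_mem_stabilizer_sergeevSpan (σ j)
  exact this _ (perm_mem_sergeevSpan _)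

theorem sergeevSpan_le_of_mem {B : Subalgebra ℂ A} (hc : ∀ i, c i ∈ B)
    (hs : ∀ σ, s σ ∈ B) : sergeevSpan c s ≤ B.toSubmodule := by
  refine Submodule.span_le.2 ?_
  rintro _ ⟨⟨t, σ⟩, rfl⟩
  refine B.mul_mem (Subalgebra.list_prod_mem _ fun x hx => ?_) (hs σ)
  obtain ⟨j, _, rfl⟩ := List.mem_map.1 hx
  dsimp only
  split_ifs
  · exact hc j
  · exact B.one_mem

theorem IsSergeevSystem.sergeevSpan_mul_mem (hS : IsSergeevSystem c s) {g h : A}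
    (hg : g ∈ sergeevSpan c s) (hh : h ∈ sergeevSpan c s) :
    g * h ∈ sergeevSpan c s :=
  sergeevSpan_le_of_mem hS.c_mem_stabilizer_sergeevSpan hS.perm_mem_stabilizer_sergeevSpan hg h hh

theorem mem_of_forall_simple {B : Subalgebra ℂ A}
    (h : ∀ i i' : Fin n, (i : ℕ) + 1 = i' → s (swap i i') ∈ B)
    (σ : Equiv.Perm (Fin n)) : s σ ∈ B := by
  cases n with
  | zero => rw [Subsingleton.elim σ 1, map_one]; exact B.one_mem
  | succ m =>
    have hσ : σ ∈ Submonoid.closure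
        (Set.range fun i : Fin m => swap i.castSucc i.succ) := by
      rw [Equiv.Perm.mclosure_swap_castSucc_succ]; trivial
    have : Submonoid.closure (Set.range fun i : Fin m => swap i.castSucc i.succ) ≤
        B.toSubmonoid.comap s := by
      refine Submonoid.closure_le.2 ?_
      rintro _ ⟨i, rfl⟩
      exact h _ _ (by simp)
    exact this hσ

theorem IsSergeevSystem.mem_stabilizer_degreeOne_mul (hS : IsSergeevSystem c s) {g : A}
    (hg : g ∈ sergeevSpan c s)
    (h : ∀ i, ∀ k ∈ sergeevSpan c s, g * (a i * k) ∈ degreeOne a * sergeevSpan c s) :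
    g ∈ stabilizerSubalgebra A (degreeOne a * sergeevSpan c s) := by
  intro m hm
  refine Submodule.mul_induction_on hm (fun d hd k hk => ?_) fun x y hx hy => ?_
  · rw [smul_eq_mul]
    have h1 : (1 : A) ∈ degreeOne a := Submodule.subset_span (Set.mem_insert _ _)
    induction hd using Submodule.span_induction with
    | mem d hd =>
      rcases hd with rfl | ⟨i, rfl⟩
      · rw [one_mul]
        simpa using Submodule.mul_mem_mul h1 (hS.sergeevSpan_mul_mem hg hk)
      · exact h i k hk
    | zero => simp
    | add x y _ _ hx hy => rw [add_mul, mul_add]; exact add_mem hx hy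
    | smul r x _ hx =>
      rw [smul_mul_assoc, mul_smul_comm]; exact Submodule.smul_mem _ r hx
  · rw [smul_add]; exact add_mem hx hy

theorem IsSergeevSystem.c_mem_sergeevSpan (hS : IsSergeevSystem c s) (i : Fin n) :
    c i ∈ sergeevSpan c s := by
  simpa using hS.c_mem_stabilizer_sergeevSpan i 1 one_mem_sergeevSpan

theorem a_mem_degreeOne (i : Fin n) : a i ∈ degreeOne a :=
  Submodule.subset_span (Set.mem_insert_of_mem _ ⟨i, rfl⟩)

theorem one_mem_degreeOne : (1 : A) ∈ degreeOne a :=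
  Submodule.subset_span (Set.mem_insert _ _)

theorem IsAffineSystem.c_mem_stabilizer_degreeOne_mul (hA : IsAffineSystem c s a) (i : Fin n) :
    c i ∈ stabilizerSubalgebra A (degreeOne a * sergeevSpan c s) := by
  refine hA.sergeev.mem_stabilizer_degreeOne_mul (hA.sergeev.c_mem_sergeevSpan i) fun j k hk => ?_
  have hm := Submodule.mul_mem_mul (a_mem_degreeOne (a := a) j)
    (hA.sergeev.sergeevSpan_mul_mem (hA.sergeev.c_mem_sergeevSpan i) hk)
  rw [← mul_assoc] at hm ⊢
  rcases eq_or_ne j i with rfl | hji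
  · have : c j * a j = -(a j * c j) := hA.c_a_same j
    rw [this, neg_mul]
    exact neg_mem hm
  · have : c i * a j = a j * c i := hA.c_a_ne j i hji
    rwa [this]

theorem IsAffineSystem.simple_mem_stabilizer_degreeOne_mul (hA : IsAffineSystem c s a)
    (i i' : Fin n) (hi : (i : ℕ) + 1 = i') :
    s (swap i i') ∈ stabilizerSubalgebra A (degreeOne a * sergeevSpan c s) := by
  have hne : i ≠ i' := by rintro rfl; omega
  have hs := perm_mem_sergeevSpan (c := c) (s := s) (swap i i')
  have hss : s (swap i i') * s (swap i i') = 1 := by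
    rw [← map_mul, Equiv.swap_mul_self, map_one]
  have hsucc : a i' * s (swap i i') - s (swap i i') * a i = 1 - c i' * c i := hA.a_perm_succ i i' hi
  have h1 : s (swap i i') * a i = a i' * s (swap i i') - (1 - c i' * c i) := by
    rw [← hsucc]; abel
  have h2 : s (swap i i') * a i' = a i * s (swap i i') + (1 - c i * c i') := by
    have e : s (swap i i') * (1 - c i' * c i) * s (swap i i') =
        1 - c i * c i' := by
      have e1 : s (swap i i') * (c i' * c i) = c i * c i' * s (swap i i') := by
        rw [← mul_assoc, hA.sergeev.perm_c, mul_assoc, hA.sergeev.perm_c, mul_assoc]; simp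
      rw [mul_sub, sub_mul, e1, mul_one, hss, mul_assoc, hss, mul_one]
    rw [← e, ← hsucc, mul_sub, sub_mul, mul_assoc, mul_assoc, hss, mul_one, ← mul_assoc, hss,
      one_mul]
    noncomm_ring [hss]
  refine hA.sergeev.mem_stabilizer_degreeOne_mul hs fun j k hk => ?_
  have hcc : ∀ i i' : Fin n, (1 - c i * c i') * k ∈ degreeOne a * sergeevSpan c s := fun i i' => by
    rw [← one_mul ((1 - c i * c i') * k)]
    exact Submodule.mul_mem_mul one_mem_degreeOne (hA.sergeev.sergeevSpan_mul_mem
      (sub_mem one_mem_sergeevSpan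
        (hA.sergeev.sergeevSpan_mul_mem (hA.sergeev.c_mem_sergeevSpan i)
          (hA.sergeev.c_mem_sergeevSpan i'))) hk)
  have hm : ∀ j, a j * (s (swap i i') * k) ∈ degreeOne a * sergeevSpan c s := fun j =>
    Submodule.mul_mem_mul (a_mem_degreeOne j) (hA.sergeev.sergeevSpan_mul_mem hs hk)
  rw [← mul_assoc]
  rcases eq_or_ne j i with rfl | hji
  · rw [h1, sub_mul, mul_assoc]
    exact sub_mem (hm _) (hcc _ _)
  rcases eq_or_ne j i' with rfl | hji'
  · rw [h2, add_mul, mul_assoc]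
    exact add_mem (hm _) (hcc _ _)
  have : a j * s (swap i i') = s (swap i i') * a j := hA.a_perm_ne i i' j hi hji hji'
  rw [← this, mul_assoc]
  exact hm j

/-- An element of the Sergeev algebra can be moved to the right of one `a i`, at the cost of terms
without any `a j`. -/
theorem IsAffineSystem.sergeevSpan_mul_a (hA : IsAffineSystem c s a)
    {g : A} (hg : g ∈ sergeevSpan c s) (i : Fin n) :
    g * a i ∈ degreeOne a * sergeevSpan c s := by
  have h := sergeevSpan_le_of_mem hA.c_mem_stabilizer_degreeOne_mul
    (mem_of_forall_simple hA.simple_mem_stabilizer_degreeOne_mul) hg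
  have := h _ (Submodule.mul_mem_mul (a_mem_degreeOne i) one_mem_sergeevSpan)
  simpa using this

theorem a_mem_stabilizer_pbwSpan (i : Fin n) :
    a i ∈ stabilizerSubalgebra A (pbwSpan c s a) := by
  refine mem_stabilizerSubalgebra_span.2 ?_
  rintro _ ⟨⟨L, t, σ⟩, rfl⟩
  refine Submodule.subset_span ⟨(i :: L, t, σ), ?_⟩
  simp [pbwMonomial, mul_assoc]

theorem sergeevSpan_le_pbwSpan : sergeevSpan c s ≤ pbwSpan c s a := by
  refine Submodule.span_le.2 ?_
  rintro _ ⟨⟨t, σ⟩, rfl⟩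
  exact Submodule.subset_span ⟨([], t, σ), by simp [pbwMonomial]⟩

/-- Moving an element of the Sergeev algebra past a whole word, by induction on the length. -/
theorem IsAffineSystem.sergeevSpan_mul_word (hA : IsAffineSystem c s a)
    (L : List (Fin n)) {g k : A} (hg : g ∈ sergeevSpan c s)
    (hk : k ∈ sergeevSpan c s) : g * ((L.map a).prod * k) ∈ pbwSpan c s a := by
  induction L generalizing g with
  | nil => simpa using sergeevSpan_le_pbwSpan (hA.sergeev.sergeevSpan_mul_mem hg hk)
  | cons i L ih =>
    rw [List.map_cons, List.prod_cons, mul_assoc, ← mul_assoc]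
    have hd : degreeOne a ≤ (stabilizerSubalgebra A (pbwSpan c s a)).toSubmodule := by
      refine Submodule.span_le.2 ?_
      rintro _ (rfl | ⟨i, rfl⟩)
      · exact Subalgebra.one_mem _
      · exact a_mem_stabilizer_pbwSpan i
    refine Submodule.mul_induction_on (hA.sergeevSpan_mul_a hg i) (fun d hdm m hm => ?_)
      fun x y hx hy => ?_
    · rw [mul_assoc]
      exact hd hdm _ (ih hm)
    · rw [add_mul]; exact add_mem hx hy

theorem IsAffineSystem.pbwSpan_eq_top (hA : IsAffineSystem c s a)
    (htop : Algebra.adjoin ℂ (Set.range c ∪ Set.range a ∪ Set.range s) = ⊤) :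
    pbwSpan c s a = ⊤ := by
  have hH : ∀ g ∈ sergeevSpan c s, g ∈ stabilizerSubalgebra A (pbwSpan c s a) := by
    intro g hg
    refine mem_stabilizerSubalgebra_span.2 ?_
    rintro _ ⟨⟨L, t, σ⟩, rfl⟩
    exact hA.sergeevSpan_mul_word L hg (sergeevMonomial_mem t σ)
  have hstab : stabilizerSubalgebra A (pbwSpan c s a) = ⊤ := by
    rw [eq_top_iff, ← htop]
    refine Algebra.adjoin_le ?_
    rintro _ ((⟨i, rfl⟩ | ⟨i, rfl⟩) | ⟨σ, rfl⟩)
    · exact hH _ (hA.sergeev.c_mem_sergeevSpan i)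
    · exact a_mem_stabilizer_pbwSpan i
    · exact hH _ (perm_mem_sergeevSpan σ)
  rw [eq_top_iff]
  rintro x -
  have hx : x ∈ stabilizerSubalgebra A (pbwSpan c s a) := by rw [hstab]; trivial
  simpa using hx 1 (sergeevSpan_le_pbwSpan one_mem_sergeevSpan)

/-- The monomials indexed by multisets already span, since the generators `a i` commute. -/
theorem IsAffineSystem.span_pbwMonomial_multiset (hA : IsAffineSystem c s a)
    (htop : Algebra.adjoin ℂ (Set.range c ∪ Set.range a ∪ Set.range s) = ⊤) :
    Submodule.span ℂ
    (Set.range fun x : Multiset (Fin n) × (Fin n → Bool) × Equiv.Perm (Fin n) =>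
      pbwMonomial c s a x.1.toList x.2.1 x.2.2) = ⊤ := by
  rw [eq_top_iff, ← hA.pbwSpan_eq_top htop]
  refine Submodule.span_mono ?_
  rintro _ ⟨⟨L, t, σ⟩, rfl⟩
  refine ⟨((L : Multiset (Fin n)), t, σ), ?_⟩
  have hp : (Multiset.toList (L : Multiset (Fin n))).Perm L := by
    rw [← Multiset.coe_eq_coe, Multiset.coe_toList]
  simp only [pbwMonomial]
  congr 1
  refine (hp.map a).prod_eq' (List.pairwise_map.2
    (List.pairwise_of_forall fun i j => hA.a_comm _ _))

end Spanning

namespace AffHC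

variable {n : ℕ}

/-- The permutations in the degenerate affine Hecke-Clifford algebra, as a homomorphism. -/
noncomputable def permHom (n : ℕ) : Equiv.Perm (Fin n) →* AffHC n where
  toFun := perm
  map_one' := (RingQuot.mkAlgHom_rel ℂ AffHCRel.perm_one).trans (map_one _)
  map_mul' σ τ := (RingQuot.mkAlgHom_rel ℂ (AffHCRel.perm_mul σ τ)).trans (map_mul _ _ _)

theorem mk_rel {p q : FreeAlgebra ℂ (AffHCGen n)} (h : AffHCRel n p q) :
    RingQuot.mkAlgHom ℂ (AffHCRel n) p = RingQuot.mkAlgHom ℂ (AffHCRel n) q :=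
  RingQuot.mkAlgHom_rel ℂ h

theorem isAffineSystem : IsAffineSystem (c (n := n)) (permHom n) a where
  sergeev :=
    { perm_c := fun σ i => by
        have := mk_rel (AffHCRel.perm_c σ i); simp only [map_mul] at this; exact this
      c_sq := fun i => by
        have := mk_rel (AffHCRel.c_sq i); simp only [map_mul, map_one] at this; exact this
      c_anticomm := fun i j h => by
        have := mk_rel (AffHCRel.c_anticomm i j h)
        simp only [map_mul, map_neg] at this; exact this }
  a_comm i j := by
    have := mk_rel (AffHCRel.a_comm i j); simp only [map_mul] at this; exact this
  a_perm_ne i i' j hi h h' := by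
    have := mk_rel (AffHCRel.a_perm_ne i i' j hi h h'); simp only [map_mul] at this; exact this
  a_perm_succ i i' hi := by
    have := mk_rel (AffHCRel.a_perm_succ i i' hi)
    simp only [map_mul, map_sub, map_one] at this; exact this
  c_a_same i := by
    have := mk_rel (AffHCRel.c_a_same i); simp only [map_mul, map_neg] at this; exact this
  c_a_ne i j h := by
    have := mk_rel (AffHCRel.c_a_ne i j h); simp only [map_mul] at this; exact this

theorem adjoin_eq_top : Algebra.adjoin ℂ
    (Set.range (c (n := n)) ∪ Set.range (a (n := n)) ∪ Set.range (permHom n)) = ⊤ := by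
  rw [eq_top_iff]
  rintro x -
  obtain ⟨w, rfl⟩ := RingQuot.mkAlgHom_surjective ℂ (AffHCRel n) x
  induction w using FreeAlgebra.induction with
  | grade0 r => rw [AlgHom.commutes]; exact Subalgebra.algebraMap_mem _ r
  | grade1 g =>
    apply Algebra.subset_adjoin
    cases g with
    | a i => exact Or.inl (Or.inr ⟨i, rfl⟩)
    | c i => exact Or.inl (Or.inl ⟨i, rfl⟩)
    | perm σ => exact Or.inr ⟨σ, rfl⟩
  | mul x y hx hy => rw [map_mul]; exact mul_mem hx hy
  | add x y hx hy => rw [map_add]; exact add_mem hx hy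

end AffHC

/-! ### Leading terms in the model -/

/-- A family is linearly independent if it has functionals that are triangular with respect to
some degree, with nonzero diagonal. -/
theorem linearIndependent_of_triangular {ι V : Type*} [AddCommGroup V] [Module ℂ V] (f : ι → V)
    (ℓ : ι → V →ₗ[ℂ] ℂ) (deg : ι → ℕ) (hdiag : ∀ x, ℓ x (f x) ≠ 0)
    (hoff : ∀ x x', x' ≠ x → deg x ≤ deg x' → ℓ x' (f x) = 0) : LinearIndependent ℂ f := by
  classical
  rw [linearIndependent_iff']
  intro S g hg
  by_contra! hne
  obtain ⟨i, hiS, hi⟩ := hne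
  obtain ⟨m, hm, hmax⟩ := (S.filter fun i => g i ≠ 0).exists_max_image deg
    ⟨i, Finset.mem_filter.2 ⟨hiS, hi⟩⟩
  rw [Finset.mem_filter] at hm
  have h := congrArg (ℓ m) hg
  rw [map_sum, map_zero, Finset.sum_eq_single_of_mem m hm.1] at h
  · rw [map_smul, smul_eq_mul] at h
    exact (mul_ne_zero hm.2 (hdiag m)) h
  · intro k hk hkm
    rw [map_smul, smul_eq_mul]
    by_cases hgk : g k = 0
    · rw [hgk, zero_mul]
    · rw [hoff k m hkm.symm (hmax k (Finset.mem_filter.2 ⟨hk, hgk⟩)), mul_zero]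

theorem injective_of_linearIndependent_image {ι A V : Type*} [AddCommGroup A] [Module ℂ A]
    [AddCommGroup V] [Module ℂ V] (Φ : A →ₗ[ℂ] V) (e : ι → A)
    (he : Submodule.span ℂ (Set.range e) = ⊤) (hli : LinearIndependent ℂ fun i => Φ (e i)) :
    Function.Injective Φ := by
  rw [injective_iff_map_eq_zero]
  intro x hx
  have hmem : x ∈ Submodule.span ℂ (Set.range e) := by rw [he]; trivial
  obtain ⟨l, rfl⟩ := (Finsupp.mem_span_range_iff_exists_finsupp).1 hmem
  rw [linearIndependent_iff] at hli
  have : l = 0 := by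
    apply hli
    rw [Finsupp.linearCombination_apply, ← hx, Finsupp.sum, Finsupp.sum, map_sum]
    simp
  simp [this]

namespace DunklModel

open MvPolynomial (X C coeff monomial)

variable {n : ℕ}

/-- The functions whose values have no terms of degree `d` or more; for `d = 0` only zero is left.
-/
def lowDegree (n d : ℕ) : Submodule ℂ (Space n) where
  carrier := {v | ∀ i m, d ≤ m.degree → coeff m (v i) = 0}
  add_mem' hv hw i m hm := by
    rw [Pi.add_apply, MvPolynomial.coeff_add, hv i m hm, hw i m hm, add_zero]
  zero_mem' i m _ := by simp
  smul_mem' r v hv i m hm := by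
    rw [Pi.smul_apply, MvPolynomial.coeff_smul, hv i m hm, smul_zero]

theorem opC_mem (d : ℕ) (j : Fin n) :
    opC j ∈ stabilizerSubalgebra (Module.End ℂ (Space n)) (lowDegree n d) :=
  fun v hv i m hm => by
    rw [Module.End.smul_def, opC_apply, MvPolynomial.coeff_C_mul, hv _ m hm, mul_zero]

theorem opP_mem (d : ℕ) (σ : Equiv.Perm (Fin n)) :
    opP σ ∈ stabilizerSubalgebra (Module.End ℂ (Space n)) (lowDegree n d) :=
  fun v hv i m hm => by rw [Module.End.smul_def, opP_apply, hv _ m hm]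

theorem opS_mem (d : ℕ) (σ : Equiv.Perm (Fin n)) :
    opS σ ∈ stabilizerSubalgebra (Module.End ℂ (Space n)) (lowDegree n d) :=
  fun v hv i m hm => by rw [Module.End.smul_def, opS_apply, hv _ m hm]

theorem opY_mem (d : ℕ) (j : Fin n) :
    opY j ∈ stabilizerSubalgebra (Module.End ℂ (Space n)) (lowDegree n d) :=
  fun v hv i m hm => by
    rw [Module.End.smul_def, opY_apply, MvPolynomial.coeff_C_mul, hv _ m hm, mul_zero]

theorem opDiff_mem (d : ℕ) (j k : Fin n) :
    opDiff j k ∈ stabilizerSubalgebra (Module.End ℂ (Space n)) (lowDegree n d) :=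
  fun v hv i m hm => by
    rw [Module.End.smul_def, opDiff_apply, MvPolynomial.coeff_C_mul, MvPolynomial.coeff_sub,
      hv _ m hm, hv _ m hm, sub_zero, mul_zero]

theorem oddSwap_mem {R : Type*} [Ring R] [Algebra ℂ R] {B : Subalgebra ℂ R} {c : Fin n → R}
    {s : Equiv.Perm (Fin n) →* R} (hc : ∀ i, c i ∈ B) (hs : ∀ σ, s σ ∈ B) (i k : Fin n) :
    oddSwap c s i k ∈ B :=
  B.mul_mem (B.add_mem B.one_mem (B.mul_mem (hc k) (hc i))) (hs _)

theorem opXi_lowDegree {d : ℕ} (j : Fin n) {v : Space n} (hv : v ∈ lowDegree n d) :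
    opXi j v ∈ lowDegree n (d + 1) := by
  intro i m hm
  rw [opXi_apply, mul_assoc, MvPolynomial.coeff_C_mul, MvPolynomial.coeff_X_mul']
  split_ifs with h
  · rw [hv, mul_zero]
    have hle : Finsupp.single (i.2.1⁻¹ j) 1 ≤ m := by
      rw [Finsupp.single_le_iff]
      exact Nat.one_le_iff_ne_zero.2 (Finsupp.mem_support_iff.1 h)
    have := congrArg Finsupp.degree (tsub_add_cancel_of_le hle)
    rw [map_add, Finsupp.degree_single] at this
    omega
  · rw [mul_zero]

theorem lowDegree_mono {d e : ℕ} (h : d ≤ e) : lowDegree n d ≤ lowDegree n e :=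
  fun _ hv i m hm => hv i m (h.trans hm)

/-- The image `y_j x_j + M_j` of the generator `a_j` in the model. -/
noncomputable def opA (j : Fin n) : Module.End ℂ (Space n) :=
  opY j * dunkl opC opP opXi opDiff j + oddJucysMurphy opC opS j

/-- The part of `opA j` that does not raise the degree. -/
noncomputable def opLower (j : Fin n) : Module.End ℂ (Space n) :=
  opY j * ∑ k, opDiff j k * oddSwap opC opP j k + oddJucysMurphy opC opS j

theorem opA_eq (j : Fin n) : opA j = opY j * opXi j + opLower j := by
  rw [opA, opLower, dunkl, mul_add, add_assoc]

theorem opLower_mem (d : ℕ) (j : Fin n) :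
    opLower j ∈ stabilizerSubalgebra (Module.End ℂ (Space n)) (lowDegree n d) :=
  Subalgebra.add_mem _
    (Subalgebra.mul_mem _ (opY_mem d j) (Subalgebra.sum_mem _ fun k _ =>
      Subalgebra.mul_mem _ (opDiff_mem d j k) (oddSwap_mem (opC_mem d) (opP_mem d) j k)))
    (Subalgebra.sum_mem _ fun k _ => oddSwap_mem (opC_mem d) (opS_mem d) j k)

theorem weightedShift_single {I K : Type*} [DecidableEq I] [CommRing K] [Algebra ℂ K]
    (a : I → K) {f : I → I} (hf : Function.Injective f) (p : I) (Q : K) :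
    weightedShift a f (Pi.single (f p) Q) = Pi.single p (a p * Q) := by
  ext i
  rw [weightedShift_apply]
  rcases eq_or_ne i p with rfl | h
  · simp
  · rw [Pi.single_eq_of_ne h, Pi.single_eq_of_ne (hf.ne h), mul_zero]

theorem weightedShift_id_single {I K : Type*} [DecidableEq I] [CommRing K] [Algebra ℂ K]
    (a : I → K) (p : I) (Q : K) :
    weightedShift a id (Pi.single p Q) = Pi.single p (a p * Q) :=
  weightedShift_single a Function.injective_id p Q

theorem opS_single (σ τ ρ : Equiv.Perm (Fin n)) (t : Fin n → Bool) (Q : MvPolynomial (Fin n) ℂ) :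
    opS σ (Pi.single (τ, ρ, t) Q) = Pi.single (σ * τ, σ * ρ, t) Q := by
  have hf : Function.Injective
      (fun i : Index n => ((σ⁻¹ * i.1, σ⁻¹ * i.2.1, i.2.2) : Index n)) := by
    rintro ⟨a, b, c⟩ ⟨a', b', c'⟩ h
    simpa using h
  have := weightedShift_single (K := MvPolynomial (Fin n) ℂ) 1 hf (σ * τ, σ * ρ, t) Q
  simp only [inv_mul_cancel_left, Pi.one_apply, one_mul] at this
  exact this

theorem opC_single (j : Fin n) (τ ρ : Equiv.Perm (Fin n)) (t : Fin n → Bool)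
    (Q : MvPolynomial (Fin n) ℂ) :
    opC j (Pi.single (τ, ρ, t) Q) = Pi.single (τ, ρ, flipAt (ρ⁻¹ j) t)
      (C (jwSign (ρ⁻¹ j) (flipAt (ρ⁻¹ j) t)) * Q) := by
  have hf : Function.Injective
      (fun i : Index n => ((i.1, i.2.1, flipAt (i.2.1⁻¹ j) i.2.2) : Index n)) := by
    apply Function.Involutive.injective
    rintro ⟨a, b, c⟩
    simp [flipAt_flipAt]
  have := weightedShift_single (fun i : Index n => C (jwSign (i.2.1⁻¹ j) i.2.2)) hf
    (τ, ρ, flipAt (ρ⁻¹ j) t) Q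
  rwa [flipAt_flipAt] at this

theorem opY_opXi_single (j : Fin n) (τ ρ : Equiv.Perm (Fin n)) (t : Fin n → Bool)
    (Q : MvPolynomial (Fin n) ℂ) :
    (opY j * opXi j) (Pi.single (τ, ρ, t) Q) = Pi.single (τ, ρ, t)
      (C (node (τ⁻¹ j) * boolSign (t (ρ⁻¹ j))) * (X (ρ⁻¹ j) * Q)) := by
  rw [Module.End.mul_apply, opXi, opY, weightedShift_id_single, weightedShift_id_single]
  simp only [map_mul, mul_assoc]

/-- The basis vector to which all monomials are applied. -/
noncomputable def vacuum (n : ℕ) : Space n := Pi.single (1, 1, fun _ => false) 1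

/-- A Clifford word flips exactly the bits it contains, read off at `σ k`. -/
theorem cliffordWord_single (σ : Equiv.Perm (Fin n)) {l : List (Fin n)} (hl : l.Nodup)
    (t : Fin n → Bool) : ∃ κ : ℂ, κ ≠ 0 ∧
      cliffordWord opC l t (Pi.single (σ, σ, fun _ => false) 1 : Space n) =
        Pi.single (σ, σ, fun k => decide (σ k ∈ l) && t (σ k)) (C κ) := by
  induction l with
  | nil => exact ⟨1, one_ne_zero, by simp [cliffordWord]⟩
  | cons j l ih =>
    rw [List.nodup_cons] at hl
    obtain ⟨κ, hκ, h⟩ := ih hl.2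
    rw [cliffordWord_cons, Module.End.mul_apply, h]
    by_cases htj : t j
    · refine ⟨jwSign (σ⁻¹ j) (flipAt (σ⁻¹ j) fun k => decide (σ k ∈ l) && t (σ k)) * κ,
        mul_ne_zero (jwSign_ne_zero _ _) hκ, ?_⟩
      rw [if_pos htj, opC_single, ← map_mul]
      congr 3
      ext k
      rcases eq_or_ne k (σ⁻¹ j) with rfl | hk
      · simp [flipAt_self, htj, hl.1]
      · have : σ k ≠ j := fun e => hk (by simp [← e])
        rw [flipAt_ne hk]
        simp [this]
    · refine ⟨κ, hκ, ?_⟩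
      rw [if_neg htj, Module.End.one_apply]
      congr 3
      ext k
      by_cases hk : σ k = j
      · simp [hk, htj]
      · simp [hk]

theorem sergeevMonomial_vacuum (t : Fin n → Bool) (σ : Equiv.Perm (Fin n)) : ∃ κ : ℂ, κ ≠ 0 ∧
    sergeevMonomial opC opS t σ (vacuum n) = Pi.single (σ, σ, t ∘ σ) (C κ) := by
  obtain ⟨κ, hκ, h⟩ := cliffordWord_single σ (List.nodup_finRange n) t
  refine ⟨κ, hκ, ?_⟩
  rw [sergeevMonomial, Module.End.mul_apply, vacuum, opS_single, mul_one, h]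
  congr 3
  ext k
  simp

/-- The exponent of the monomial `∏ X (ρ⁻¹ j)`, over the elements `j` of a multiset. -/
noncomputable def exponent (ρ : Equiv.Perm (Fin n)) (s : Multiset (Fin n)) : Fin n →₀ ℕ :=
  Multiset.toFinsupp (s.map ⇑(ρ⁻¹))

theorem exponent_cons (ρ : Equiv.Perm (Fin n)) (j : Fin n) (s : Multiset (Fin n)) :
    exponent ρ (j ::ₘ s) = Finsupp.single (ρ⁻¹ j) 1 + exponent ρ s := by
  rw [exponent, Multiset.map_cons, ← Multiset.singleton_add, map_add, Multiset.toFinsupp_singleton]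
  rfl

theorem degree_exponent (ρ : Equiv.Perm (Fin n)) (s : Multiset (Fin n)) :
    (exponent ρ s).degree = s.card := by
  induction s using Multiset.induction with
  | empty => simp [exponent]
  | cons j s ih => rw [exponent_cons, map_add, ih, Finsupp.degree_single, Multiset.card_cons,
      add_comm]

theorem exponent_injective (ρ : Equiv.Perm (Fin n)) : Function.Injective (exponent ρ) :=
  Multiset.toFinsupp.injective.comp (Multiset.map_injective ρ⁻¹.injective)

theorem single_monomial_mem (p : Index n) (m : Fin n →₀ ℕ) (κ : ℂ) :
    (Pi.single p (monomial m κ) : Space n) ∈ lowDegree n (m.degree + 1) := by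
  intro i m' hm'
  rcases eq_or_ne i p with rfl | h
  · rw [Pi.single_eq_same, MvPolynomial.coeff_monomial, if_neg]
    rintro rfl
    omega
  · rw [Pi.single_eq_of_ne h, MvPolynomial.coeff_zero]

/-- The leading term of a word in the operators `opA j` applied to a basis vector. -/
theorem word_leading (τ ρ : Equiv.Perm (Fin n)) (t : Fin n → Bool) {κ₀ : ℂ} (hκ₀ : κ₀ ≠ 0)
    (L : List (Fin n)) : ∃ κ : ℂ, κ ≠ 0 ∧
      (L.map opA).prod (Pi.single (τ, ρ, t) (C κ₀) : Space n) -
        Pi.single (τ, ρ, t) (monomial (exponent ρ L) κ) ∈ lowDegree n L.length := by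
  induction L with
  | nil =>
    refine ⟨κ₀, hκ₀, ?_⟩
    have : exponent ρ (([] : List (Fin n)) : Multiset (Fin n)) = 0 := by simp [exponent]
    rw [this, List.map_nil, List.prod_nil, Module.End.one_apply, MvPolynomial.C_apply, sub_self]
    exact zero_mem _
  | cons j L ih =>
    obtain ⟨κ, hκ, h⟩ := ih
    set w := (L.map opA).prod (Pi.single (τ, ρ, t) (C κ₀) : Space n)
    set e : Space n := Pi.single (τ, ρ, t) (monomial (exponent ρ L) κ) with he
    refine ⟨node (τ⁻¹ j) * boolSign (t (ρ⁻¹ j)) * κ,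
      mul_ne_zero (mul_ne_zero (node_ne_zero _) (boolSign_ne_zero _)) hκ, ?_⟩
    have h1 : (opY j * opXi j) e = Pi.single (τ, ρ, t)
        (monomial (exponent ρ ((j :: L : List (Fin n)) : Multiset (Fin n)))
          (node (τ⁻¹ j) * boolSign (t (ρ⁻¹ j)) * κ)) := by
      rw [he, opY_opXi_single, ← Multiset.cons_coe, exponent_cons, MvPolynomial.X,
        MvPolynomial.monomial_mul, MvPolynomial.C_mul_monomial, one_mul]
    have he' : e ∈ lowDegree n (L.length + 1) := by
      have := single_monomial_mem (n := n) (τ, ρ, t) (exponent ρ L) κ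
      rwa [degree_exponent, Multiset.coe_card] at this
    have h2 : (List.map opA (j :: L)).prod (Pi.single (τ, ρ, t) (C κ₀) : Space n) -
        (opY j * opXi j) e =
        opY j (opXi j (w - e)) + opLower j (w - e) + opLower j e := by
      rw [List.map_cons, List.prod_cons, Module.End.mul_apply, opA_eq, LinearMap.add_apply,
        Module.End.mul_apply, Module.End.mul_apply, map_sub, map_sub, map_sub]
      abel
    rw [← h1, h2, List.length_cons]
    refine add_mem (add_mem ?_ ?_) ?_
    · exact opY_mem _ j _ (opXi_lowDegree j h)
    · exact lowDegree_mono (Nat.le_succ _) (opLower_mem _ j _ h)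
    · exact opLower_mem _ j _ he'

theorem pbwMonomial_vacuum (L : List (Fin n)) (t : Fin n → Bool) (σ : Equiv.Perm (Fin n)) :
    ∃ κ : ℂ, κ ≠ 0 ∧ pbwMonomial opC opS opA L t σ (vacuum n) -
      Pi.single (σ, σ, t ∘ σ) (monomial (exponent σ L) κ) ∈ lowDegree n L.length := by
  obtain ⟨κ₀, hκ₀, h⟩ := sergeevMonomial_vacuum t σ
  obtain ⟨κ, hκ, h'⟩ := word_leading σ σ (t ∘ σ) hκ₀ L
  refine ⟨κ, hκ, ?_⟩
  rw [pbwMonomial, Module.End.mul_apply, h]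
  exact h'

/-- The PBW monomials, with the `a j` acting by `opA j`, give linearly independent vectors: their
leading terms are nonzero multiples of distinct monomial basis vectors. -/
theorem linearIndependent_pbwMonomial : LinearIndependent ℂ
    fun x : Multiset (Fin n) × (Fin n → Bool) × Equiv.Perm (Fin n) =>
      pbwMonomial opC opS opA x.1.toList x.2.1 x.2.2 (vacuum n) := by
  have key : ∀ x x' : Multiset (Fin n) × (Fin n → Bool) × Equiv.Perm (Fin n),
      x.1.card ≤ x'.1.card → ∃ κ : ℂ, κ ≠ 0 ∧
      coeff (exponent x'.2.2 x'.1) (pbwMonomial opC opS opA x.1.toList x.2.1 x.2.2 (vacuum n)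
        (x'.2.2, x'.2.2, x'.2.1 ∘ x'.2.2)) = if x' = x then κ else 0 := by
    -- The leading term of the monomial `x` sits at the point `(σ, σ, t ∘ σ)` in degree `card s`, so
    -- the remaining terms are invisible in degrees at least `card s`.
    rintro ⟨s, t, σ⟩ ⟨s', t', σ'⟩ hle
    obtain ⟨κ, hκ, h⟩ := pbwMonomial_vacuum s.toList t σ
    refine ⟨κ, hκ, ?_⟩
    have h1 := h (σ', σ', t' ∘ σ') (exponent σ' s') (by
      rw [degree_exponent, Multiset.length_toList]; exact hle)
    rw [Pi.sub_apply, MvPolynomial.coeff_sub, sub_eq_zero, Multiset.coe_toList] at h1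
    dsimp only
    rw [h1]
    split_ifs with hx
    · simp only [Prod.mk.injEq] at hx
      obtain ⟨rfl, rfl, rfl⟩ := hx
      rw [Pi.single_eq_same, MvPolynomial.coeff_monomial, if_pos rfl]
    · by_cases hp : ((σ', σ', t' ∘ σ') : Index n) = (σ, σ, t ∘ σ)
      · simp only [Prod.mk.injEq] at hp
        obtain ⟨rfl, -, ht⟩ := hp
        have ht : t' = t := σ'.surjective.injective_comp_right ht
        subst ht
        rw [Pi.single_eq_same, MvPolynomial.coeff_monomial, if_neg]
        intro he
        exact hx (by rw [exponent_injective _ he])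
      · rw [Pi.single_eq_of_ne hp, MvPolynomial.coeff_zero]
  refine linearIndependent_of_triangular _
    (fun x => (MvPolynomial.lcoeff ℂ (exponent x.2.2 x.1)).comp
      (LinearMap.proj (x.2.2, x.2.2, x.2.1 ∘ x.2.2))) (fun x => x.1.card) (fun x => ?_)
    fun x x' hne hle => ?_
  · obtain ⟨κ, hκ, h⟩ := key x x le_rfl
    rw [if_pos rfl] at h
    intro h0
    exact hκ (h.symm.trans h0)
  · obtain ⟨κ, _, h⟩ := key x x' hle
    rw [if_neg hne] at h
    exact h

theorem map_pbwMonomial {A B : Type*} [Ring A] [Algebra ℂ A] [Ring B] [Algebra ℂ B]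
    (φ : A →ₐ[ℂ] B) {c : Fin n → A} {s : Equiv.Perm (Fin n) →* A} {a : Fin n → A}
    {c' : Fin n → B} {s' : Equiv.Perm (Fin n) →* B} {a' : Fin n → B} (hc : ∀ i, φ (c i) = c' i)
    (hs : ∀ σ, φ (s σ) = s' σ) (ha : ∀ i, φ (a i) = a' i) (L : List (Fin n)) (t : Fin n → Bool)
    (σ : Equiv.Perm (Fin n)) :
    φ (pbwMonomial c s a L t σ) = pbwMonomial c' s' a' L t σ := by
  have h1 : (φ ∘ fun j => if t j then c j else 1) = fun j => if t j then c' j else 1 := by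
    ext j; by_cases h : t j <;> simp [h, hc]
  have h2 : φ ∘ a = a' := funext ha
  simp only [pbwMonomial, sergeevMonomial, cliffordWord, map_mul, map_list_prod, List.map_map,
    hs, h1, h2]

/-- The degenerate affine Hecke-Clifford algebra acts faithfully on the model. -/
theorem affineHom_injective : Function.Injective (isDAHCSystem (n := n)).affineHom := by
  set φ := (isDAHCSystem (n := n)).affineHom
  have hinj : Function.Injective
      ((LinearMap.applyₗ (R := ℂ) (vacuum n)).comp φ.toLinearMap) := by
    refine injective_of_linearIndependent_image _ _
      (AffHC.isAffineSystem.span_pbwMonomial_multiset AffHC.adjoin_eq_top) ?_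
    have hfun := funext fun x : Multiset (Fin n) × (Fin n → Bool) × Equiv.Perm (Fin n) =>
      congrArg (fun T : Module.End ℂ (Space n) => T (vacuum n))
        (map_pbwMonomial φ (s := AffHC.permHom n) (s' := opS) isDAHCSystem.affineHom_c
          isDAHCSystem.affineHom_perm isDAHCSystem.affineHom_a x.1.toList x.2.1 x.2.2)
    have hli := linearIndependent_pbwMonomial (n := n)
    exact hfun.symm ▸ hli
  intro x y hxy
  apply hinj
  change φ x (vacuum n) = φ y (vacuum n)
  rw [hxy]

end DunklModel

/-! ### Rescaling and shift of the generators -/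

namespace IsDAHCSystem

variable {n : ℕ} {R : Type*} [Ring R] [Algebra ℂ R] {c : Fin n → R}
  {s : Equiv.Perm (Fin n) →* R} {x y : Fin n → R}

/-- The relations with parameter `u` become those with parameter `1` for `y / u + α`: adding a
common scalar to the `y i` affects neither their commutators nor their behaviour under `c` and
`s`. -/
theorem of_rescaled {u : ℂ} (hu : u ≠ 0) (α : ℂ) (hS : IsSergeevSystem c s)
    (hx : IsOddFamily c s x) (y_comm : ∀ i j, y i * y j = y j * y i)
    (perm_y : ∀ σ i, s σ * y i = y (σ i) * s σ) (c_y : ∀ i j, c j * y i = y i * c j)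
    (y_x_ne : ∀ i j, i ≠ j → y j * x i - x i * y j = u • oddSwap c s i j)
    (y_x_same : ∀ i, y i * x i - x i * y i =
      -(u • ∑ k ∈ Finset.univ.erase i, oddSwap c s i k)) :
    IsDAHCSystem c s x (fun i => u⁻¹ • y i + algebraMap ℂ R α) := by
  have hα : ∀ r : R, r * algebraMap ℂ R α = algebraMap ℂ R α * r := fun r =>
    (Algebra.commutes α r).symm
  have hlie : ∀ i j, (u⁻¹ • y j + algebraMap ℂ R α) * x i - x i * (u⁻¹ • y j + algebraMap ℂ R α) =
      u⁻¹ • (y j * x i - x i * y j) := fun i j => by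
    rw [add_mul, mul_add, hα, smul_mul_assoc, mul_smul_comm, smul_sub]; abel
  refine ⟨hS, hx, fun i j => ?_, fun σ i => ?_, fun i j => ?_, fun i j hij => ?_, fun i => ?_⟩
  · simp only [add_mul, mul_add, hα, smul_mul_assoc, mul_smul_comm, y_comm i j, smul_add]; abel
  · rw [add_mul, mul_add, hα, smul_mul_assoc, mul_smul_comm, perm_y]
  · rw [add_mul, mul_add, hα, smul_mul_assoc, mul_smul_comm, c_y]
  · rw [hlie, y_x_ne i j hij, inv_smul_smul₀ hu]
  · rw [hlie, y_x_same i, smul_neg, inv_smul_smul₀ hu]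

variable (h : IsDAHCSystem c s x y) (u α : ℂ)

/-- The homomorphism from the free algebra that undoes the rescaling and the shift of
`of_rescaled`. -/
noncomputable def freeHom (c : Fin n → R) (s : Equiv.Perm (Fin n) →* R) (x y : Fin n → R)
    (u α : ℂ) : FreeAlgebra ℂ (DAHCaGen n) →ₐ[ℂ] R :=
  FreeAlgebra.lift ℂ fun g : DAHCaGen n => match g with
    | .x i => x i
    | .y i => u • (y i - algebraMap ℂ R α)
    | .c i => c i
    | .perm σ => s σ

theorem freeHom_X (i : Fin n) : freeHom c s x y u α (DAHCaGen.X i) = x i := by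
  simp [freeHom, DAHCaGen.X]

theorem freeHom_Y (i : Fin n) :
    freeHom c s x y u α (DAHCaGen.Y i) = u • (y i - algebraMap ℂ R α) := by
  simp [freeHom, DAHCaGen.Y]

theorem freeHom_C (i : Fin n) : freeHom c s x y u α (DAHCaGen.C i) = c i := by
  simp [freeHom, DAHCaGen.C]

theorem freeHom_S (σ : Equiv.Perm (Fin n)) : freeHom c s x y u α (DAHCaGen.S σ) = s σ := by
  simp [freeHom, DAHCaGen.S]

include h in
theorem freeHom_rel ⦃p q : FreeAlgebra ℂ (DAHCaGen n)⦄ (hr : DAHCaRel n u p q) :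
    freeHom c s x y u α p = freeHom c s x y u α q := by
  have hα : ∀ r : R, r * algebraMap ℂ R α = algebraMap ℂ R α * r := fun r =>
    (Algebra.commutes α r).symm
  have hlie : ∀ i j, u • (y j - algebraMap ℂ R α) * x i - x i * (u • (y j - algebraMap ℂ R α)) =
      u • (y j * x i - x i * y j) := fun i j => by
    rw [smul_mul_assoc, mul_smul_comm, ← smul_sub, sub_mul, mul_sub, hα, sub_sub_sub_cancel_right]
  induction hr <;>
    simp only [map_mul, map_one, map_neg, map_sub, map_add, map_smul, map_sum, freeHom_X,
      freeHom_Y, freeHom_C, freeHom_S]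
  case x_comm i j => exact h.odd.comm i j
  case y_comm i j =>
    simp only [smul_mul_assoc, mul_smul_comm, sub_mul, mul_sub, hα, h.y_comm i j, smul_sub]
    abel
  case perm_x σ i => exact h.odd.perm σ i
  case perm_y σ i => simp only [smul_mul_assoc, mul_smul_comm, sub_mul, mul_sub, hα, h.perm_y]
  case perm_c σ i => exact h.sergeev.perm_c σ i
  case c_x_same i => exact h.odd.c_same i
  case c_x_ne i j hij => exact h.odd.c_ne i j hij
  case c_y i j => simp only [smul_mul_assoc, mul_smul_comm, sub_mul, mul_sub, hα, h.c_y]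
  case c_sq i => exact h.sergeev.c_sq i
  case c_anticomm i j hij => exact h.sergeev.c_anticomm i j hij
  case y_x_ne i j hij => rw [hlie, h.y_x_ne i j hij]; rfl
  case y_x_same i =>
    rw [hlie, h.y_x_same i, smul_neg]
    simp only [oddSwap, Equiv.swap_comm i]

/-- A system with parameter `1` is a representation of the double affine Hecke-Clifford algebra
with parameter `u`, in which `y_i / u + α` acts as the given `y i`. -/
noncomputable def dahcHom : DAHCa n u →ₐ[ℂ] R :=
  RingQuot.liftAlgHom ℂ ⟨freeHom c s x y u α, h.freeHom_rel u α⟩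

theorem dahcHom_mk (p : FreeAlgebra ℂ (DAHCaGen n)) :
    h.dahcHom u α (RingQuot.mkAlgHom ℂ (DAHCaRel n u) p) = freeHom c s x y u α p := by
  simp [dahcHom]

end IsDAHCSystem

namespace DAHCa

variable {n : ℕ} {u : ℂ}

theorem mk_rel {p q : FreeAlgebra ℂ (DAHCaGen n)} (h : DAHCaRel n u p q) :
    RingQuot.mkAlgHom ℂ (DAHCaRel n u) p = RingQuot.mkAlgHom ℂ (DAHCaRel n u) q :=
  RingQuot.mkAlgHom_rel ℂ h

/-- The permutations in the double affine Hecke-Clifford algebra, as a homomorphism. -/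
noncomputable def permHom (n : ℕ) (u : ℂ) : Equiv.Perm (Fin n) →* DAHCa n u where
  toFun := perm u
  map_one' := (mk_rel DAHCaRel.perm_one).trans (map_one _)
  map_mul' σ τ := (mk_rel (DAHCaRel.perm_mul σ τ)).trans (map_mul _ _ _)

theorem isSergeev : IsSergeevSystem (c (n := n) u) (permHom n u) where
  perm_c σ i := by
    have := mk_rel (u := u) (DAHCaRel.perm_c σ i); simp only [map_mul] at this; exact this
  c_sq i := by
    have := mk_rel (u := u) (DAHCaRel.c_sq i); simp only [map_mul, map_one] at this; exact this
  c_anticomm i j h := by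
    have := mk_rel (u := u) (DAHCaRel.c_anticomm i j h)
    simp only [map_mul, map_neg] at this; exact this

theorem isOdd : IsOddFamily (c (n := n) u) (permHom n u) (x u) where
  comm i j := by
    have := mk_rel (u := u) (DAHCaRel.x_comm i j); simp only [map_mul] at this; exact this
  perm σ i := by
    have := mk_rel (u := u) (DAHCaRel.perm_x σ i); simp only [map_mul] at this; exact this
  c_same i := by
    have := mk_rel (u := u) (DAHCaRel.c_x_same i)
    simp only [map_mul, map_neg] at this; exact this
  c_ne i j h := by
    have := mk_rel (u := u) (DAHCaRel.c_x_ne i j h); simp only [map_mul] at this; exact this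

theorem isDAHCSystem (hu : u ≠ 0) (α : ℂ) : IsDAHCSystem (c (n := n) u) (permHom n u) (x u)
    (fun i => u⁻¹ • y u i + algebraMap ℂ (DAHCa n u) α) := by
  refine IsDAHCSystem.of_rescaled hu α isSergeev isOdd (fun i j => ?_) (fun σ i => ?_)
    (fun i j => ?_) (fun i j h => ?_) (fun i => ?_)
  · have := mk_rel (u := u) (DAHCaRel.y_comm i j); simp only [map_mul] at this; exact this
  · have := mk_rel (u := u) (DAHCaRel.perm_y σ i); simp only [map_mul] at this; exact this
  · have := mk_rel (u := u) (DAHCaRel.c_y i j); simp only [map_mul] at this; exact this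
  · have := mk_rel (DAHCaRel.y_x_ne (u := u) i j h)
    simp only [map_mul, map_sub, map_smul, map_add, map_one] at this
    exact this
  · have := mk_rel (DAHCaRel.y_x_same (u := u) i)
    simp only [map_mul, map_sub, map_smul, map_add, map_one, map_neg, map_sum] at this
    simp only [oddSwap, Equiv.swap_comm i]
    exact this

/-- The shift by `α` absorbs the summand `α x_i`: the element `α x_i + z_i` is `y'_i x_i + M_i`
for `y'_i = y_i / u + α`. -/
theorem affine_eq (α : ℂ) (i : Fin n) :
    (u⁻¹ • y u i + algebraMap ℂ (DAHCa n u) α) * x u i +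
      oddJucysMurphy (c u) (permHom n u) i = α • x u i + z u i := by
  have : oddJucysMurphy (c u) (permHom n u) i = jucysMurphy u i := by
    refine Finset.sum_congr rfl fun k hk => ?_
    have hk := (Finset.mem_Iio.1 hk).ne
    rw [oddSwap, isSergeev.c_anticomm k i hk, Equiv.swap_comm i k, ← sub_eq_add_neg]
    rfl
  rw [this, z, add_mul, smul_mul_assoc, ← Algebra.smul_def]
  abel

end DAHCa

theorem mainTheorem5 (n : ℕ) (u : ℂ) (hu : u ≠ 0) (α : ℂ) :
    ∃ e : AffHC n ≃ₐ[ℂ] DAHCa.affineSubalgebra n u α,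
      (∀ i : Fin n, (e (AffHC.a i) : DAHCa n u) = α • DAHCa.x u i + DAHCa.z u i) ∧
      (∀ i : Fin n, (e (AffHC.c i) : DAHCa n u) = DAHCa.c u i) ∧
      (∀ σ : Equiv.Perm (Fin n), (e (AffHC.perm σ) : DAHCa n u) = DAHCa.perm u σ) := by
  have hD := DAHCa.isDAHCSystem (n := n) hu α
  have hM := DunklModel.isDAHCSystem (n := n)
  have hc : ∀ i, hD.affineHom (AffHC.c i) = DAHCa.c u i := hD.affineHom_c
  have hs : ∀ σ, hD.affineHom (AffHC.perm σ) = DAHCa.perm u σ := hD.affineHom_perm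
  have ha : ∀ i, hD.affineHom (AffHC.a i) = α • DAHCa.x u i + DAHCa.z u i := fun i =>
    (hD.affineHom_a i).trans (DAHCa.affine_eq α i)
  have hψc : ∀ i, hM.dahcHom u α (DAHCa.c u i) = DunklModel.opC i := fun i =>
    (hM.dahcHom_mk u α _).trans (IsDAHCSystem.freeHom_C u α i)
  have hψs : ∀ σ, hM.dahcHom u α (DAHCa.permHom n u σ) = DunklModel.opS σ := fun σ =>
    (hM.dahcHom_mk u α _).trans (IsDAHCSystem.freeHom_S u α σ)
  have hψx : ∀ i, hM.dahcHom u α (DAHCa.x u i) = _ := fun i =>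
    (hM.dahcHom_mk u α _).trans (IsDAHCSystem.freeHom_X u α i)
  have hψy : ∀ i, hM.dahcHom u α (DAHCa.y u i) = _ := fun i =>
    (hM.dahcHom_mk u α _).trans (IsDAHCSystem.freeHom_Y u α i)
  have hcomp : (hM.dahcHom u α).comp hD.affineHom = hM.affineHom := by
    refine AlgHom.ext_of_adjoin_eq_top AffHC.adjoin_eq_top ?_
    rintro _ ((⟨i, rfl⟩ | ⟨i, rfl⟩) | ⟨σ, rfl⟩)
    · rw [AlgHom.comp_apply, hc, hψc, hM.affineHom_c]
    · rw [AlgHom.comp_apply, hD.affineHom_a, hM.affineHom_a]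
      simp only [oddJucysMurphy, oddSwap, map_add, map_mul, map_sum, map_one, map_smul, hψc, hψs,
        hψx, hψy, AlgHom.commutes, inv_smul_smul₀ hu, sub_add_cancel]
    · exact (congrArg _ (hs σ)).trans ((hψs σ).trans (hM.affineHom_perm σ).symm)
  have hinj : Function.Injective hD.affineHom := by
    have := DunklModel.affineHom_injective (n := n)
    rw [← hcomp] at this
    exact Function.Injective.of_comp this
  have hrange : hD.affineHom.range = DAHCa.affineSubalgebra n u α := by
    rw [← Algebra.map_top, ← AffHC.adjoin_eq_top, AlgHom.map_adjoin, DAHCa.affineSubalgebra,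
      Set.image_union, Set.image_union, ← Set.range_comp, ← Set.range_comp, ← Set.range_comp]
    congr 3
    · exact congrArg Set.range (funext hc)
    · exact congrArg Set.range (funext ha)
    · exact funext hs
  exact ⟨(AlgEquiv.ofInjective hD.affineHom hinj).trans (Subalgebra.equivOfEq _ _ hrange),
    ha, hc, hs⟩
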